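/- An alternating sign matrix (ASM) is a square matrix in which each entry is $0$, $1$ or $-1$, the nonzero entries alternate in sign along each row and column, and the sum of the entries in each row and each column is $1$. Let $\mathrm{ASM}(n)$ denote the set of all $n\times n$ ASMs. For $A\in\mathrm{ASM}(n)$ define \[ \nu(A)=\sum_{\substack{1\le i<i'\le n\\ 1\le j'\le j\le n}}A_{ij}\,A_{i'j'}, \] which is a nonnegative integer, let $\mu(A)$ be the number of entries of $A$ equal to $-1$, and let $\rho(A)$ be the number of $0$'s to the left of the $1$ in the first row of $A$. For elements $x,y,z$ of a commutative ring put \[ Z_{\mathrm{ASM}}(n,x,y,z)=\sum_{A\in\mathrm{ASM}(n)}x^{\nu(A)}\,y^{\mu(A)}\,z^{\rho(A)}. \] **Proposition.** Let $n\ge 0$ be an integer, let $R$ be a commutative ring (for example $R=\mathbb{C}$), let $x,y\in R$ be arbitrary, and let $\omega\in R$ be any solution of \[ y\,\omega^2+(1-x-y)\,\omega+x=0 . \] Let $M_{\mathrm{ASM}}(n,x,y,1)$ be the $n\times n$ matrix over $R$ with entries \[ M_{\mathrm{ASM}}(n,x,y,1)_{ij}=(1-\omega)\,\delta_{ij}+\omega\sum_{k=0}^{\min(i,j)}\binom{i}{k}\binom{j}{k}x^k\,y^{i-k},\qquad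 0\le i,j\le n-1 . \] Then \[ Z_{\mathrm{ASM}}(n,x,y,1)=\det M_{\mathrm{ASM}}(n,x,y,1). \] (For $n=0$ both sides are $1$.) -/

import Mathlib

namespace AlternatingSign

/-- The nonzero terms of the sequence `f` alternate in sign: every nonzero term is followed, as
the next nonzero term, by one of the opposite sign. (For entries in `{0, 1, -1}`, having the
opposite sign means being the negative.) -/
def Alternates {n : ℕ} (f : Fin n → ℤ) : Prop :=
  ∀ j j' : Fin n, j < j' → f j ≠ 0 → f j' ≠ 0 → (∀ k, j < k → k < j' → f k = 0) → f j' = -f j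

/-- Alternating sign matrices: entries `0`, `1` or `-1`, the nonzero entries alternate in sign
along each row and column, and each row and column has sum `1`. -/
structure IsASM {n : ℕ} (A : Matrix (Fin n) (Fin n) ℤ) : Prop where
  entry : ∀ i j, A i j = 0 ∨ A i j = 1 ∨ A i j = -1
  row_alternates : ∀ i, Alternates fun j => A i j
  col_alternates : ∀ j, Alternates fun i => A i j
  row_sum : ∀ i, ∑ j, A i j = 1
  col_sum : ∀ j, ∑ i, A i j = 1

theorem finite_isASM (n : ℕ) : {A : Matrix (Fin n) (Fin n) ℤ | IsASM A}.Finite := by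
  have h : {A : Fin n → Fin n → ℤ |
      ∀ i, A i ∈ {v : Fin n → ℤ | ∀ j, v j ∈ ({0, 1, -1} : Set ℤ)}}.Finite :=
    Set.Finite.pi' fun _ => Set.Finite.pi' fun _ => Set.toFinite _
  exact h.subset fun A hA i j => hA.entry i j

/-- The finite set `ASM(n)` of all `n × n` alternating sign matrices. -/
noncomputable def ASM (n : ℕ) : Finset (Matrix (Fin n) (Fin n) ℤ) :=
  (finite_isASM n).toFinset

theorem mem_ASM {n : ℕ} (A : Matrix (Fin n) (Fin n) ℤ) : A ∈ ASM n ↔ IsASM A := by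
  simp [ASM]

/-- The integer `∑ A i j * A i' j'` over all `i < i'` and `j' ≤ j`. -/
def nuInt {n : ℕ} (A : Matrix (Fin n) (Fin n) ℤ) : ℤ :=
  ∑ i, ∑ i', ∑ j, ∑ j', if i < i' ∧ j' ≤ j then A i j * A i' j' else 0

/-- The statistic `ν(A)`, as a natural number; see `coe_nu` for the fact that nothing is lost. -/
def nu {n : ℕ} (A : Matrix (Fin n) (Fin n) ℤ) : ℕ := (nuInt A).toNat

/-- The statistic `μ(A)`: the number of entries equal to `-1`. -/
def mu {n : ℕ} (A : Matrix (Fin n) (Fin n) ℤ) : ℕ :=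
  (Finset.univ.filter fun p : Fin n × Fin n => A p.1 p.2 = -1).card

/-- The statistic `ρ(A)`: the number of `0`s to the left of the `1` in the first row. -/
def rho {n : ℕ} (A : Matrix (Fin n) (Fin n) ℤ) : ℕ :=
  (Finset.univ.filter fun p : Fin n × Fin n =>
    (p.1 : ℕ) = 0 ∧ A p.1 p.2 = 0 ∧ ∃ j', p.2 < j' ∧ A p.1 j' = 1).card

/-- The generating function `Z_ASM(n, x, y, z)`. -/
noncomputable def ZASM {R : Type*} [CommRing R] (n : ℕ) (x y z : R) : R :=
  ∑ A ∈ ASM n, x ^ nu A * y ^ mu A * z ^ rho A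

/-- The matrix `M_ASM(n, x, y, 1)`, for a given value of `ω`. -/
def MASM {R : Type*} [CommRing R] (n : ℕ) (x y ω : R) : Matrix (Fin n) (Fin n) R :=
  Matrix.of fun i j =>
    (1 - ω) * (if i = j then 1 else 0) +
      ω * ∑ k ∈ Finset.range (min (i : ℕ) (j : ℕ) + 1),
        ((i : ℕ).choose k : R) * ((j : ℕ).choose k : R) * x ^ k * y ^ ((i : ℕ) - k)

/-- Initial sums of an alternating sequence with sum `1` are nonnegative. -/
theorem Alternates.sum_nonneg {n : ℕ} {f : Fin n → ℤ} (hf : Alternates f)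
    (he : ∀ j, f j = 0 ∨ f j = 1 ∨ f j = -1) (hs : ∑ j, f j = 1) (m : ℕ) :
    0 ≤ ∑ j : Fin n with j.val < m, f j := by
  have step : ∀ k (hk : k < n), ∑ j : Fin n with j.val < k + 1, f j =
      ∑ j : Fin n with j.val < k, f j + f ⟨k, hk⟩ := by
    intro k hk
    have : (Finset.univ.filter fun j : Fin n => (j : ℕ) < k + 1) =
        insert ⟨k, hk⟩ (Finset.univ.filter fun j : Fin n => (j : ℕ) < k) := by
      ext j; simp [Fin.ext_iff]; omega
    rw [this, Finset.sum_insert (by simp), add_comm]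
  have step' : ∀ k, n ≤ k → ∑ j : Fin n with j.val < k, f j = 1 := by
    intro k hk
    rw [← hs]
    congr 1
    ext j; simp; omega
  -- the sum of a nonempty sequence of alternating terms is determined by its last nonzero term
  have key : ∀ k, k ≤ n →
      ((∑ j : Fin n with j.val < k, f j = 0 ∧ ∀ j : Fin n, (j : ℕ) < k → f j = 0) ∨
      ∃ l : Fin n, (l : ℕ) < k ∧ f l ≠ 0 ∧ (∀ j : Fin n, l < j → (j : ℕ) < k → f j = 0) ∧
        ∃ e : ℤ, (e = 1 ∨ e = -1) ∧
          (∑ j : Fin n with j.val < k, f j = if f l = e then e else 0) ∧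
          ∀ k', k' ≤ k → (∑ j : Fin n with j.val < k', f j = 0 ∨ ∑ j : Fin n with j.val < k', f j = e)) := by
    intro k
    induction k with
    | zero => intro _; left; simp
    | succ k ih =>
      intro hk
      have hk' : k < n := hk
      have hst := step k hk'
      rcases ih hk'.le with ⟨h0, hz⟩ | ⟨l, hl, hl0, hlz, e, he1, hsum, hall⟩
      · by_cases hfk : f ⟨k, hk'⟩ = 0
        · left
          refine ⟨by rw [hst, h0, hfk]; rfl, fun j hj => ?_⟩
          rcases Nat.lt_succ_iff_lt_or_eq.1 hj with h | h
          · exact hz j h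
          · have : j = ⟨k, hk'⟩ := Fin.ext h
            rw [this, hfk]
        · right
          refine ⟨⟨k, hk'⟩, Nat.lt_succ_self k, hfk, fun j hj hj' => ?_, f ⟨k, hk'⟩, ?_, ?_, ?_⟩
          · have : k < (j : ℕ) := hj
            omega
          · exact (he _).resolve_left hfk
          · rw [hst, h0]; simp
          · intro k' hk''
            rcases Nat.lt_or_ge k k' with h | h
            · right
              have : k' = k + 1 := by omega
              rw [this, hst, h0, zero_add]
            · left
              refine Finset.sum_eq_zero fun j hj => hz j ?_
              simp at hj; omega
      · right
        by_cases hfk : f ⟨k, hk'⟩ = 0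
        · refine ⟨l, by omega, hl0, fun j hj hj' => ?_, e, he1, by rw [hst, hfk, add_zero, hsum], ?_⟩
          · rcases Nat.lt_succ_iff_lt_or_eq.1 hj' with h | h
            · exact hlz j hj h
            · have : j = ⟨k, hk'⟩ := Fin.ext h
              rw [this, hfk]
          · intro k' hk''
            rcases Nat.lt_or_ge k k' with h | h
            · have : k' = k + 1 := by omega
              rw [this, hst, hfk, add_zero]
              exact hall k le_rfl
            · exact hall k' h
        · have hneg : f ⟨k, hk'⟩ = -f l :=
            hf l ⟨k, hk'⟩ hl hl0 hfk fun j h1 h2 => hlz j h1 h2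
          have hsum' : ∑ j : Fin n with j.val < k + 1, f j = if f ⟨k, hk'⟩ = e then e else 0 := by
            rw [hst, hsum, hneg]
            have := (he l).resolve_left hl0
            rcases this with h | h <;> rcases he1 with h' | h' <;> simp [h, h']
          refine ⟨⟨k, hk'⟩, Nat.lt_succ_self k, hfk, fun j hj hj' => ?_, e, he1, hsum', ?_⟩
          · have : k < (j : ℕ) := hj
            omega
          · intro k' hk''
            rcases Nat.lt_or_ge k k' with h | h
            · have : k' = k + 1 := by omega
              rw [this, hsum']
              split_ifs <;> simp
            · exact hall k' h
  rcases Nat.lt_or_ge m n with hm | hm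
  · have hn := step' n le_rfl
    rcases key n le_rfl with ⟨h0, _⟩ | ⟨_, _, _, _, e, he1, _, hall⟩
    · omega
    · have h1 := hall n le_rfl
      have h2 := hall m hm.le
      omega
  · rw [step' m hm]; norm_num

/-- The statistic `ν` is nonnegative on alternating sign matrices. -/
theorem nuInt_nonneg {n : ℕ} {A : Matrix (Fin n) (Fin n) ℤ} (hA : IsASM A) : 0 ≤ nuInt A := by
  have h : nuInt A = ∑ i' : Fin n, ∑ j : Fin n,
      (∑ i : Fin n with i.val < (i' : ℕ), A i j) * ∑ j' : Fin n with j'.val < (j : ℕ) + 1, A i' j' := by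
    unfold nuInt
    rw [Finset.sum_comm]
    refine Finset.sum_congr rfl fun i' _ => ?_
    rw [Finset.sum_comm]
    refine Finset.sum_congr rfl fun j _ => ?_
    rw [Finset.sum_filter, Finset.sum_filter, Finset.sum_mul_sum]
    refine Finset.sum_congr rfl fun i _ => Finset.sum_congr rfl fun j' _ => ?_
    have h1 : i < i' ↔ (i : ℕ) < (i' : ℕ) := Iff.rfl
    have h2 : j' ≤ j ↔ (j' : ℕ) < (j : ℕ) + 1 := Nat.lt_succ_iff.symm
    simp only [h1, h2]
    by_cases a : (i : ℕ) < (i' : ℕ) <;> by_cases b : (j' : ℕ) < (j : ℕ) + 1 <;> simp [a, b]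
  rw [h]
  refine Finset.sum_nonneg fun i' _ => Finset.sum_nonneg fun j _ => mul_nonneg ?_ ?_
  · exact (hA.col_alternates j).sum_nonneg (fun i => hA.entry i j) (hA.col_sum j) _
  · exact (hA.row_alternates i').sum_nonneg (hA.entry i') (hA.row_sum i') _

theorem coe_nu {n : ℕ} {A : Matrix (Fin n) (Fin n) ℤ} (hA : IsASM A) : (nu A : ℤ) = nuInt A :=
  Int.toNat_of_nonneg (nuInt_nonneg hA)

end AlternatingSign

/-! Recording whether each row or column partial sum is `0` or `1` turns an ASM into a six-vertex
configuration with domain walls, and `ν` and `μ` become products of local vertex weights. The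
weights are deformed by a spectral parameter for each row and column; setting all of these to `0`
recovers `ZASM n x y 1` (`ZASM_one_eq_partitionFn`).

The deformed weights satisfy a Yang–Baxter equation, so the partition function is symmetric in the
column parameters. It also has low degree in the first row parameter and factors when `u v = 1` at a
corner. Interpolation then yields a denominator-free Izergin–Korepin formula
(`izerginKorepin_of_generic`): the partition function times two Vandermonde determinants is the
determinant of the matrix with entries `1 / (wtA * wtB)`, each row multiplied by its common
denominator.

Taking parameters proportional to `X`, cancelling the Vandermonde determinants and putting `X = 0`
leaves the determinant of the Taylor coefficients of `1 / (wtA * wtB)` (`partitionFn_zero_eq_det`).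
As this is a polynomial identity in `x, y`, it passes from the fraction field of `ℤ[x, y]` to every
commutative ring. Finally, `(1 - ω) / wtA + ω / wtB` equals `1 / (wtA * wtB)` times a function of
`u` times a function of `v` exactly by the equation for `ω`, so unitriangular row and column
operations turn the coefficient matrix into `MASM` (`masm_coeff_eq`). -/

namespace AlternatingSign

/-! ### Vertex weights and the Yang–Baxter equation. -/

section SixVertex

variable {R S : Type*} [CommRing R] [CommRing S]

/-- The weight of the zero entries whose left and top edges agree (up to a factor `x`). -/
def wtA (u v : R) : R := 1 - u * v

/-- The weight of the zero entries whose left and top edges differ. -/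
def wtB (x y u v : R) : R := 1 - y * u - v + (y - x) * u * v

/-- The row factor of the weight of the entries `-1`. -/
def wtG (x y u : R) : R := 1 - (1 - x + y) * u + y * u ^ 2

/-- The column factor of the weight of the entries `-1`. -/
def wtH (x y v : R) : R := y - (1 - x + y) * v + v ^ 2

/-- The weight of a vertex with left edge `h`, top edge `c`, right edge `h'` and bottom
edge `c'`, in this order of arguments. -/
def vertexWt (x y u v : R) : Bool → Bool → Bool → Bool → R
  | false, false, false, false => wtA u v
  | true, true, true, true => x * wtA u v
  | false, true, false, true => wtB x y u v
  | true, false, true, false => wtB x y u v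
  | false, false, true, true => 1
  | true, true, false, false => wtG x y u * wtH x y v
  | _, _, _, _ => 0

/-- The diagonal weight of the matrix that intertwines two columns. -/
def crossDiag (x y v v' : R) : R := y - v - (y - x) * v' + v * v'

/-- The matrix that intertwines two columns, with arguments in the order: incoming edges,
outgoing edges. -/
def crossWt (x y v v' : R) : Bool → Bool → Bool → Bool → R
  | false, false, false, false => crossDiag x y v v'
  | true, true, true, true => crossDiag x y v v'
  | true, false, true, false => wtH x y v
  | false, true, false, true => wtH x y v'
  | false, true, true, false => x * (v' - v)
  | true, false, false, true => v' - v
  | _, _, _, _ => 0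

set_option maxHeartbeats 1000000 in
/-- The Yang–Baxter equation. -/
theorem yang_baxter (x y u v v' : R) (h h' t₁ t₂ d₁ d₂ : Bool) :
    ∑ k, ∑ m₁, ∑ m₂, vertexWt x y u v h t₁ k m₁ * vertexWt x y u v' k t₂ h' m₂ *
        crossWt x y v v' m₁ m₂ d₁ d₂ =
      ∑ k, ∑ m₁, ∑ m₂, crossWt x y v v' t₁ t₂ m₁ m₂ *
        (vertexWt x y u v' h m₁ k d₁ * vertexWt x y u v k m₂ h' d₂) := by
  cases h <;> cases h' <;> cases t₁ <;> cases t₂ <;> cases d₁ <;> cases d₂ <;>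
    simp only [Fintype.sum_bool, vertexWt, crossWt, wtA, wtB, wtG, wtH, crossDiag] <;> ring

/-- The transfer matrix of a column with top edge `t` and bottom edge `b`; it acts on the
horizontal edges. -/
def columnMatrix (x y : R) :
    {m : ℕ} → (Fin m → R) → R → Bool → Bool → Matrix (Fin m → Bool) (Fin m → Bool) R
  | 0, _, _, t, b => Matrix.of fun _ _ => if t = b then 1 else 0
  | _ + 1, us, v, t, b => Matrix.of fun h h' =>
      ∑ k, vertexWt x y (us 0) v (h 0) t (h' 0) k *
        columnMatrix x y (Fin.tail us) v k b (Fin.tail h) (Fin.tail h')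

theorem sum_fin_succ_pi {ι : Type*} [Fintype ι] {m : ℕ} (f : (Fin (m + 1) → ι) → R) :
    ∑ h, f h = ∑ k : ι, ∑ h : Fin m → ι, f (Fin.cons k h) := by
  rw [← Fintype.sum_prod_type']
  exact (Fintype.sum_equiv (Fin.consEquiv fun _ => ι) _ _ fun _ => rfl).symm

theorem columnMatrix_mul_succ (x y : R) {m : ℕ} (us : Fin (m + 1) → R) (v v' : R)
    (t₁ b₁ t₂ b₂ : Bool) (h h' : Fin (m + 1) → Bool) :
    (columnMatrix x y us v t₁ b₁ * columnMatrix x y us v' t₂ b₂) h h' =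
      ∑ k, ∑ m₁, ∑ m₂, vertexWt x y (us 0) v (h 0) t₁ k m₁ *
        vertexWt x y (us 0) v' k t₂ (h' 0) m₂ *
        (columnMatrix x y (Fin.tail us) v m₁ b₁ * columnMatrix x y (Fin.tail us) v' m₂ b₂)
          (Fin.tail h) (Fin.tail h') := by
  rw [Matrix.mul_apply, sum_fin_succ_pi]
  refine Finset.sum_congr rfl fun k _ => ?_
  simp only [columnMatrix, Matrix.of_apply, Fin.cons_zero, Fin.tail_cons, Matrix.mul_apply,
    Finset.mul_sum, Finset.sum_mul]
  rw [Finset.sum_comm]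
  rw [Finset.sum_comm' (t' := Finset.univ) (s' := fun _ => Finset.univ) (by simp)]
  simp only [Fintype.sum_bool, ← Finset.sum_add_distrib]
  refine Finset.sum_congr rfl fun _ _ => ?_
  ring

/-- Two columns may be exchanged at the cost of a crossing. -/
theorem columnMatrix_cross (x y : R) (v v' : R) {m : ℕ} (us : Fin m → R) (t₁ t₂ d₁ d₂ : Bool)
    (h h' : Fin m → Bool) :
    ∑ b₁, ∑ b₂, (columnMatrix x y us v t₁ b₁ * columnMatrix x y us v' t₂ b₂) h h' *
        crossWt x y v v' b₁ b₂ d₁ d₂ =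
      ∑ b₁, ∑ b₂, crossWt x y v v' t₁ t₂ b₁ b₂ *
        (columnMatrix x y us v' b₁ d₁ * columnMatrix x y us v b₂ d₂) h h' := by
  induction m generalizing t₁ t₂ with
  | zero =>
    simp only [columnMatrix, Matrix.mul_apply, Matrix.of_apply]
    cases t₁ <;> cases t₂ <;> cases d₁ <;> cases d₂ <;> simp
  | succ m ih =>
    have hy := fun b₁ b₂ => yang_baxter x y (us 0) v v' (h 0) (h' 0) t₁ t₂ b₁ b₂
    have ih' := fun m₁ m₂ => ih (Fin.tail us) m₁ m₂ (Fin.tail h) (Fin.tail h')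
    simp only [columnMatrix_mul_succ]
    generalize columnMatrix x y (Fin.tail us) v = C at *
    generalize columnMatrix x y (Fin.tail us) v' = C' at *
    generalize Fin.tail h = g at *
    generalize Fin.tail h' = g' at *
    -- The crossing passes the remaining rows by induction, with the first row's weights `L` as
    -- coefficients, and then the first row by Yang–Baxter.
    obtain ⟨L, hL⟩ : ∃ L : Bool → Bool → R, ∀ m₁ m₂, L m₁ m₂ =
      ∑ k, vertexWt x y (us 0) v (h 0) t₁ k m₁ * vertexWt x y (us 0) v' k t₂ (h' 0) m₂ :=
        ⟨_, fun _ _ => rfl⟩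
    simp only [Fintype.sum_bool] at *
    linear_combination (norm := (simp only [hL]; ring)) L true true * ih' true true + L true false * ih' true false +
      L false true * ih' false true + L false false * ih' false false +
      (C' true d₁ * C true d₂) g g' * hy true true +
      (C' true d₁ * C false d₂) g g' * hy true false +
      (C' false d₁ * C true d₂) g g' * hy false true +
      (C' false d₁ * C false d₂) g g' * hy false false

/-- With top edges both `false` and bottom edges both `true`, the crossing is forced to be diagonal
on either side, with the same weight `crossDiag`, which cancels. -/
theorem columnMatrix_commute [IsDomain R] (x y v v' : R) (hv : crossDiag x y v v' ≠ 0) {m : ℕ}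
    (us : Fin m → R) :
    Commute (columnMatrix x y us v false true) (columnMatrix x y us v' false true) := by
  ext h h'
  have := columnMatrix_cross x y v v' us false false true true h h'
  simp only [Fintype.sum_bool, crossWt, zero_mul, mul_zero, add_zero, zero_add] at this
  rw [mul_comm] at this
  exact mul_left_cancel₀ hv this

end SixVertex

/-! ### The domain wall partition function: symmetry and corner recursion. -/

section PartitionFunction

variable {R S : Type*} [CommRing R] [CommRing S]

/-- The product of the transfer matrices of a list of columns. -/
def columnsProd (x y : R) {m : ℕ} (us : Fin m → R) (l : List R) :
    Matrix (Fin m → Bool) (Fin m → Bool) R :=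
  (l.map fun v => columnMatrix x y us v false true).prod

/-- The partition function of the six-vertex model with domain wall boundary conditions. -/
def partitionFn (x y : R) {m n : ℕ} (us : Fin m → R) (vs : Fin n → R) : R :=
  columnsProd x y us (List.ofFn vs) (fun _ => false) fun _ => true

theorem columnsProd_cons (x y : R) {m : ℕ} (us : Fin m → R) (v : R) (l : List R) :
    columnsProd x y us (v :: l) = columnMatrix x y us v false true * columnsProd x y us l := by
  simp [columnsProd]

theorem map_vertexWt (f : R →+* S) (x y u v : R) (h c h' c' : Bool) :
    f (vertexWt x y u v h c h' c') = vertexWt (f x) (f y) (f u) (f v) h c h' c' := by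
  cases h <;> cases c <;> cases h' <;> cases c' <;> simp [vertexWt, wtA, wtB, wtG, wtH]

theorem map_columnMatrix (f : R →+* S) (x y : R) {m : ℕ} (us : Fin m → R) (v : R) (t b : Bool) :
    (columnMatrix x y us v t b).map f = columnMatrix (f x) (f y) (f ∘ us) (f v) t b := by
  induction m generalizing t with
  | zero => ext h h'; by_cases e : t = b <;> simp [columnMatrix, e]
  | succ m ih =>
    ext h h'
    have ih' := fun k => congrFun₂ (ih (Fin.tail us) k) (Fin.tail h) (Fin.tail h')
    simp only [Matrix.map_apply] at ih'
    simp only [columnMatrix, Matrix.map_apply, Matrix.of_apply, map_sum, map_mul, map_vertexWt, ih']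
    rfl

theorem map_columnsProd (f : R →+* S) (x y : R) {m : ℕ} (us : Fin m → R) (l : List R) :
    (columnsProd x y us l).map f = columnsProd (f x) (f y) (f ∘ us) (l.map f) := by
  induction l with
  | nil => simp [columnsProd]
  | cons v l ih =>
    rw [List.map_cons, columnsProd_cons, columnsProd_cons, ← ih, ← map_columnMatrix,
      ← Matrix.map_mul]

theorem map_partitionFn (f : R →+* S) (x y : R) {m n : ℕ} (us : Fin m → R) (vs : Fin n → R) :
    f (partitionFn x y us vs) = partitionFn (f x) (f y) (f ∘ us) (f ∘ vs) := by
  rw [partitionFn, partitionFn, ← List.map_ofFn, ← map_columnsProd, Matrix.map_apply]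

theorem partitionFn_comp_perm [IsDomain R] (x y : R) {m n : ℕ} (us : Fin m → R) (vs : Fin n → R)
    (hv : ∀ i j, crossDiag x y (vs i) (vs j) ≠ 0) (σ : Equiv.Perm (Fin n)) :
    partitionFn x y us (vs ∘ σ) = partitionFn x y us vs := by
  unfold partitionFn columnsProd
  rw [((σ.ofFn_comp_perm vs).map _).prod_eq']
  rw [List.pairwise_map, List.pairwise_ofFn]
  exact fun i j _ => columnMatrix_commute x y _ _ (hv _ _) us

/-- The column is frozen: a single `+1` or `-1` is excluded in turn, since a `-1` needs a left edge
`true`, and after it the path reaching the bottom must never have turned. -/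
theorem columnMatrix_true_true_false (x y : R) {m : ℕ} (us : Fin m → R) (v : R)
    (h' : Fin m → Bool) :
    columnMatrix x y us v true true (fun _ => false) h' =
      if h' = (fun _ => false) then ∏ i, wtB x y (us i) v else 0 := by
  induction m with
  | zero => simp [columnMatrix, Subsingleton.elim h' fun _ => false]
  | succ m ih =>
    have ih' := ih (Fin.tail us) (Fin.tail h')
    have ht : Fin.tail (fun _ : Fin (m + 1) => false) = fun _ => false := rfl
    have hiff : h' = (fun _ => false) ↔ h' 0 = false ∧ Fin.tail h' = fun _ => false := by
      constructor
      · rintro rfl; exact ⟨rfl, rfl⟩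
      · rintro ⟨h0, h1⟩
        rw [← Fin.cons_self_tail h', h0, h1]
        funext i
        exact Fin.cases rfl (fun _ => rfl) i
    simp only [columnMatrix, Matrix.of_apply, Fintype.sum_bool, ht, ih', hiff, Fin.prod_univ_succ]
    cases h' 0 <;> simp [vertexWt, Fin.tail]

/-- The hypothesis makes `wtA` vanish at the corner, so the corner entry must be `1`, and this
freezes the rest of the column. -/
theorem columnMatrix_corner (x y : R) {m : ℕ} (us : Fin (m + 1) → R) (v : R)
    (h : us 0 * v = 1) (k : Bool) (h' : Fin m → Bool) :
    columnMatrix x y us v false true (fun _ => false) (Fin.cons k h') =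
      if k = true ∧ h' = (fun _ => false) then ∏ i : Fin m, wtB x y (us i.succ) v else 0 := by
  have ht : Fin.tail (fun _ : Fin (m + 1) => false) = fun _ => false := rfl
  simp only [columnMatrix, Matrix.of_apply, Fintype.sum_bool, ht, Fin.tail_cons, Fin.cons_zero,
    columnMatrix_true_true_false]
  cases k <;> simp [vertexWt, wtA, h, Fin.tail]

theorem columnMatrix_cons_true (x y : R) {m : ℕ} (us : Fin (m + 1) → R) (v : R)
    (k b : Bool) (g g' : Fin m → Bool) :
    columnMatrix x y us v false b (Fin.cons true g) (Fin.cons k g') =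
      if k then wtB x y (us 0) v * columnMatrix x y (Fin.tail us) v false b g g' else 0 := by
  simp only [columnMatrix, Matrix.of_apply, Fintype.sum_bool, Fin.tail_cons, Fin.cons_zero]
  cases k <;> simp [vertexWt]

theorem columnMatrix_cons_false (x y : R) {m : ℕ} (us : Fin (m + 1) → R) (v : R)
    (k b : Bool) (g g' : Fin m → Bool) :
    columnMatrix x y us v false b (Fin.cons false g) (Fin.cons k g') =
      (if k then 1 else wtA (us 0) v) * columnMatrix x y (Fin.tail us) v k b g g' := by
  simp only [columnMatrix, Matrix.of_apply, Fintype.sum_bool, Fin.tail_cons, Fin.cons_zero]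
  cases k <;> simp [vertexWt]

/-- Top edges in the first row are all `false`; once its horizontal edge is `true` it stays so, each
vertex contributing `wtB`. -/
theorem columnsProd_cons_true (x y : R) {m : ℕ} (us : Fin (m + 1) → R) (l : List R)
    (g g' : Fin m → Bool) :
    columnsProd x y us l (Fin.cons true g) (Fin.cons true g') =
      (l.map (wtB x y (us 0))).prod * columnsProd x y (Fin.tail us) l g g' := by
  induction l generalizing g with
  | nil => simp [columnsProd, Matrix.one_apply, Fin.cons_inj]
  | cons v l ih =>
    rw [columnsProd_cons, columnsProd_cons, Matrix.mul_apply, Matrix.mul_apply, sum_fin_succ_pi]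
    simp only [columnMatrix_cons_true, Fintype.sum_bool, ih, Finset.mul_sum, List.map_cons,
      List.prod_cons]
    simp only [if_true, Bool.false_eq_true, if_false, zero_mul, Finset.sum_const_zero, add_zero]
    refine Finset.sum_congr rfl fun _ _ => ?_
    ring

theorem partitionFn_corner (x y : R) {m n : ℕ} (us : Fin (m + 1) → R) (vs : Fin (n + 1) → R)
    (h : us 0 * vs 0 = 1) :
    partitionFn x y us vs = (∏ j : Fin n, wtB x y (us 0) (vs j.succ)) *
      (∏ i : Fin m, wtB x y (us i.succ) (vs 0)) *
      partitionFn x y (fun i => us i.succ) fun j => vs j.succ := by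
  have ht : (fun _ : Fin (m + 1) => true) = Fin.cons true fun _ => true := by
    funext i; exact Fin.cases rfl (fun _ => rfl) i
  rw [partitionFn, List.ofFn_succ, columnsProd_cons, Matrix.mul_apply, sum_fin_succ_pi, ht]
  simp only [columnMatrix_corner x y us (vs 0) h, Fintype.sum_bool, columnsProd_cons_true]
  simp [partitionFn, List.map_ofFn, List.prod_ofFn]
  simp only [Fin.tail_def]
  ring

end PartitionFunction

/-! ### Degree of the partition function in the first row parameter. -/

section Degree

open Polynomial

variable {R : Type*} [CommRing R]

theorem mul_mem_degreeLT {p q : R[X]} {a n N : ℕ} (hq : q.natDegree ≤ a)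
    (hp : p ∈ degreeLT R n) (h : a + n ≤ N) : q * p ∈ degreeLT R N := by
  rw [mem_degreeLT] at *
  rcases eq_or_ne p 0 with rfl | hp0
  · simp
  · rw [← natDegree_lt_iff_degree_lt hp0] at hp
    refine lt_of_le_of_lt degree_le_natDegree ?_
    have := natDegree_mul_le (p := q) (q := p)
    exact_mod_cast (by omega : (q * p).natDegree < N)

theorem natDegree_wtA (v : R) : (wtA X (C v) : R[X]).natDegree ≤ 1 := by
  unfold wtA; compute_degree

theorem natDegree_wtB (x y v : R) : (wtB (C x) (C y) X (C v) : R[X]).natDegree ≤ 1 := by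
  have : (wtB (C x) (C y) X (C v) : R[X]) = C ((y - x) * v - y) * X + C (1 - v) := by
    simp [wtB]; ring
  rw [this]; compute_degree

theorem columnMatrix_C (x y : R) {m : ℕ} (us : Fin m → R) (v : R) (t b : Bool)
    (g g' : Fin m → Bool) :
    columnMatrix (C x) (C y) (fun i => C (us i)) (C v) t b g g' =
      C (columnMatrix x y us v t b g g') := by
  have := congrFun₂ (map_columnMatrix (C : R →+* R[X]) x y us v t b) g g'
  rw [Matrix.map_apply] at this
  exact this.symm

theorem columnsProd_cons_true_mem_degreeLT (x y : R) {m : ℕ} (us : Fin m → R) (l : List R)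
    (g g' : Fin m → Bool) :
    columnsProd (C x) (C y) (Fin.cons X fun i => C (us i) : Fin (m + 1) → R[X]) (l.map C)
      (Fin.cons true g) (Fin.cons true g') ∈ degreeLT R (l.length + 1) := by
  have h := congrFun₂ (map_columnsProd (C : R →+* R[X]) x y us l) g g'
  rw [columnsProd_cons_true, Fin.tail_cons]
  rw [Matrix.map_apply] at h
  have h' : columnsProd (C x) (C y) (fun i => C (us i)) (l.map C) g g' =
    C (columnsProd x y us l g g') := h.symm
  rw [h', Fin.cons_zero]
  refine mul_mem_degreeLT (a := l.length) (n := 1) ?_ ?_ le_rfl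
  · refine (natDegree_list_prod_le _).trans ?_
    rw [List.map_map, List.map_map]
    refine (List.sum_le_card_nsmul _ 1 ?_).trans (by simp)
    simp only [List.mem_map]
    rintro _ ⟨v, _, rfl⟩
    exact natDegree_wtB x y v
  · rw [mem_degreeLT]
    exact lt_of_le_of_lt degree_C_le (by norm_num)

/-- The first row contains no `-1`, so the quadratic `wtG` does not occur in it. Exactly one vertex,
the entry `1`, has constant weight and the others are linear, which saves one degree. -/
theorem columnsProd_cons_false_mem_degreeLT (x y : R) {m : ℕ} (us : Fin m → R) (l : List R)
    (g g' : Fin m → Bool) :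
    columnsProd (C x) (C y) (Fin.cons X fun i => C (us i) : Fin (m + 1) → R[X]) (l.map C)
      (Fin.cons false g) (Fin.cons true g') ∈ degreeLT R l.length := by
  induction l generalizing g with
  | nil => simp [columnsProd, Fin.cons_inj]
  | cons v l ih =>
    rw [List.map_cons, columnsProd_cons, Matrix.mul_apply, sum_fin_succ_pi]
    refine Submodule.sum_mem _ fun k _ => Submodule.sum_mem _ fun g'' _ => ?_
    rw [columnMatrix_cons_false, Fin.tail_cons, columnMatrix_C, Fin.cons_zero, List.length_cons]
    cases k
    · refine mul_mem_degreeLT (a := 1) ?_ (ih g'') (by omega)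
      refine natDegree_mul_C_le _ _ |>.trans ?_
      simpa using natDegree_wtA v
    · refine mul_mem_degreeLT (a := 0) ?_ (columnsProd_cons_true_mem_degreeLT x y us l g'' g')
        (by omega)
      simp

theorem partitionFn_mem_degreeLT (x y : R) {m n : ℕ} (us : Fin m → R) (vs : Fin n → R) :
    partitionFn (C x) (C y) (Fin.cons X fun i => C (us i) : Fin (m + 1) → R[X])
      (fun j => C (vs j)) ∈ degreeLT R n := by
  have ht : (fun _ : Fin (m + 1) => true) = Fin.cons true fun _ => true := by
    funext i; exact Fin.cases rfl (fun _ => rfl) i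
  have hf : (fun _ : Fin (m + 1) => false) = Fin.cons false fun _ => false := by
    funext i; exact Fin.cases rfl (fun _ => rfl) i
  have := columnsProd_cons_false_mem_degreeLT x y us (List.ofFn vs) (fun _ => false) fun _ => true
  rw [List.map_ofFn, List.length_ofFn] at this
  rw [partitionFn, ht, hf]
  exact this

end Degree

/-! ### The Izergin–Korepin determinant by interpolation. -/

section IzerginKorepin

open Polynomial Matrix

variable {R S : Type*} [CommRing R] [CommRing S]

/-- The matrix of the Izergin–Korepin determinant, with the denominators of each row cleared. -/
def ikMatrix (x y : R) {n : ℕ} (us vs : Fin n → R) : Matrix (Fin n) (Fin n) R :=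
  Matrix.of fun i j => ∏ k, if k = j then 1 else wtA (us i) (vs k) * wtB x y (us i) (vs k)

theorem map_ikMatrix (f : R →+* S) (x y : R) {n : ℕ} (us vs : Fin n → R) :
    (ikMatrix x y us vs).map f = ikMatrix (f x) (f y) (f ∘ us) (f ∘ vs) := by
  ext i j
  simp only [ikMatrix, Matrix.map_apply, Matrix.of_apply, map_prod]
  refine Finset.prod_congr rfl fun k _ => ?_
  split_ifs <;> simp [wtA, wtB]

theorem map_vandermonde (f : R →+* S) {n : ℕ} (us : Fin n → R) :
    (vandermonde us).map f = vandermonde (f ∘ us) := by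
  ext i j; simp [vandermonde_apply]

/-- The Izergin–Korepin formula for the partition function, without denominators. -/
def IzerginKorepin (x y : R) {n : ℕ} (us vs : Fin n → R) : Prop :=
  partitionFn x y us vs * (vandermonde us).det * (vandermonde vs).det = (ikMatrix x y us vs).det

theorem IzerginKorepin.map {x y : R} {n : ℕ} {us vs : Fin n → R} (f : R →+* S)
    (h : IzerginKorepin x y us vs) : IzerginKorepin (f x) (f y) (f ∘ us) (f ∘ vs) := by
  unfold IzerginKorepin at *
  rw [← map_partitionFn, ← map_ikMatrix, ← map_vandermonde, ← map_vandermonde]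
  simpa only [map_mul, RingHom.map_det, RingHom.mapMatrix_apply] using congrArg f h

theorem izerginKorepin_map_iff {x y : R} {n : ℕ} {us vs : Fin n → R} {f : R →+* S}
    (hf : Function.Injective f) :
    IzerginKorepin (f x) (f y) (f ∘ us) (f ∘ vs) ↔ IzerginKorepin x y us vs := by
  refine ⟨fun h => hf ?_, fun h => h.map f⟩
  unfold IzerginKorepin at h
  rw [← map_partitionFn, ← map_ikMatrix, ← map_vandermonde, ← map_vandermonde] at h
  simpa only [map_mul, RingHom.map_det, RingHom.mapMatrix_apply] using h

theorem det_vandermonde_succ {n : ℕ} (us : Fin (n + 1) → R) :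
    (vandermonde us).det =
      (∏ i : Fin n, (us i.succ - us 0)) * (vandermonde fun i : Fin n => us i.succ).det := by
  simp only [det_vandermonde, Fin.prod_univ_succ, Fin.prod_Ioi_zero, Fin.prod_Ioi_succ]

theorem det_vandermonde_comp_perm {n : ℕ} (vs : Fin n → R) (σ : Equiv.Perm (Fin n)) :
    (vandermonde (vs ∘ σ)).det = (Equiv.Perm.sign σ : ℤ) * (vandermonde vs).det := by
  rw [← det_permute]; rfl

theorem det_ikMatrix_comp_perm (x y : R) {n : ℕ} (us vs : Fin n → R) (σ : Equiv.Perm (Fin n)) :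
    (ikMatrix x y us (vs ∘ σ)).det = (Equiv.Perm.sign σ : ℤ) * (ikMatrix x y us vs).det := by
  rw [← det_permute']
  congr 1
  ext i j
  simp only [ikMatrix, of_apply, submatrix_apply, id]
  exact Fintype.prod_equiv σ _ _ fun k => by simp

/-- In row `0` every entry off column `0` contains the vanishing factor `wtA (us 0) (vs 0)`, so the
expansion has a single term. -/
theorem det_ikMatrix_corner (x y : R) {n : ℕ} (us vs : Fin (n + 1) → R) (h : us 0 * vs 0 = 1) :
    (ikMatrix x y us vs).det =
      (∏ j : Fin n, (us j.succ - us 0)) * (∏ j : Fin n, (vs j.succ - vs 0)) *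
      (∏ j : Fin n, wtB x y (us 0) (vs j.succ)) * (∏ i : Fin n, wtB x y (us i.succ) (vs 0)) *
      (ikMatrix x y (fun i => us i.succ) fun j => vs j.succ).det := by
  have hA : wtA (us 0) (vs 0) = 0 := by simp [wtA, h]
  have h0 : ∀ j : Fin n, ikMatrix x y us vs 0 j.succ = 0 := fun j => by
    simp [ikMatrix, Fin.prod_univ_succ, hA, (Fin.succ_ne_zero j).symm]
  have hsub : (ikMatrix x y us vs).submatrix Fin.succ (Fin.succAbove 0) =
      of fun i j => (wtA (us i.succ) (vs 0) * wtB x y (us i.succ) (vs 0)) *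
        ikMatrix x y (fun i => us i.succ) (fun j => vs j.succ) i j := by
    ext i j
    simp [ikMatrix, Fin.prod_univ_succ, (Fin.succ_ne_zero j).symm]
  rw [det_succ_row_zero, Fin.sum_univ_succ, hsub, det_mul_column]
  have h00 : ikMatrix x y us vs 0 0 = ∏ k : Fin n, wtA (us 0) (vs k.succ) *
      wtB x y (us 0) (vs k.succ) := by
    simp [ikMatrix, Fin.prod_univ_succ]
  simp only [h0, h00, mul_zero, zero_mul, Finset.sum_const_zero, add_zero, Fin.val_zero, pow_zero,
    one_mul, Finset.prod_mul_distrib]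
  -- If `u₀ v₀ = 1` then `(1 - u₀ v) (1 - u v₀) = (u - u₀) (v - v₀)`: these are the Vandermonde
  -- factors.
  have hd : (∏ k : Fin n, wtA (us 0) (vs k.succ)) * ∏ k : Fin n, wtA (us k.succ) (vs 0) =
      (∏ j : Fin n, (us j.succ - us 0)) * ∏ j : Fin n, (vs j.succ - vs 0) := by
    rw [← Finset.prod_mul_distrib, ← Finset.prod_mul_distrib]
    refine Finset.prod_congr rfl fun k _ => ?_
    unfold wtA
    linear_combination (us k.succ * vs k.succ - 1) * h
  rw [← hd]
  ring

theorem IzerginKorepin.of_corner {x y : R} {n : ℕ} {us vs : Fin (n + 1) → R}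
    (h : us 0 * vs 0 = 1)
    (ih : IzerginKorepin x y (fun i => us i.succ) fun j : Fin n => vs j.succ) :
    IzerginKorepin x y us vs := by
  unfold IzerginKorepin at *
  rw [det_ikMatrix_corner x y us vs h, ← ih, partitionFn_corner x y us vs h,
    det_vandermonde_succ us, det_vandermonde_succ vs]
  ring

theorem IzerginKorepin.of_comp_perm [IsDomain R] {x y : R} {n : ℕ} {us vs : Fin n → R}
    (hv : ∀ i j, crossDiag x y (vs i) (vs j) ≠ 0) (σ : Equiv.Perm (Fin n))
    (h : IzerginKorepin x y us (vs ∘ σ)) : IzerginKorepin x y us vs := by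
  unfold IzerginKorepin at *
  rw [partitionFn_comp_perm x y us vs hv, det_vandermonde_comp_perm, det_ikMatrix_comp_perm] at h
  have hs : ((Equiv.Perm.sign σ : ℤ) : R) * ((Equiv.Perm.sign σ : ℤ) : R) = 1 := by
    rw [← Int.cast_mul]; simp
  linear_combination ((Equiv.Perm.sign σ : ℤ) : R) * h -
    (partitionFn x y us vs * (vandermonde us).det * (vandermonde vs).det -
      (ikMatrix x y us vs).det) * hs

theorem IzerginKorepin.of_row_eq {x y : R} {n : ℕ} {us vs : Fin (n + 1) → R} (i : Fin n)
    (h : us 0 = us i.succ) : IzerginKorepin x y us vs := by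
  unfold IzerginKorepin
  rw [det_zero_of_row_eq (M := vandermonde us) (Fin.succ_ne_zero i).symm,
    det_zero_of_row_eq (M := ikMatrix x y us vs) (Fin.succ_ne_zero i).symm]
  · simp
  · ext j; simp only [ikMatrix, of_apply, h]
  · ext j; simp only [vandermonde_apply, h]

theorem det_ikMatrix_mem_degreeLT (x y : R) {n : ℕ} (us : Fin n → R) (vs : Fin (n + 1) → R) :
    (ikMatrix (C x) (C y) (Fin.cons X fun i => C (us i) : Fin (n + 1) → R[X])
      fun j => C (vs j)).det ∈ degreeLT R (2 * n + 1) := by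
  rw [det_succ_row_zero]
  refine Submodule.sum_mem _ fun j _ => ?_
  have hC : (ikMatrix (C x) (C y) (Fin.cons X fun i => C (us i) : Fin (n + 1) → R[X])
      fun j => C (vs j)).submatrix Fin.succ j.succAbove = C.mapMatrix (of fun i k =>
        ∏ l, if l = j.succAbove k then 1 else wtA (us i) (vs l) * wtB x y (us i) (vs l)) := by
    ext1 i k
    simp only [ikMatrix, submatrix_apply, of_apply, Fin.cons_succ, RingHom.mapMatrix_apply,
      map_apply, map_prod]
    refine Finset.prod_congr rfl fun l _ => ?_
    split_ifs <;> simp [wtA, wtB]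
  rw [hC, ← RingHom.map_det]
  refine mul_mem_degreeLT (a := 2 * n) (n := 1) ?_ ?_ le_rfl
  · have h1 : ((-1 : R[X]) ^ (j : ℕ)) = C ((-1) ^ (j : ℕ)) := by simp
    rw [h1]
    refine (natDegree_C_mul_le _ _).trans ?_
    simp only [ikMatrix, of_apply, Fin.cons_zero]
    refine (natDegree_prod_le _ _).trans ?_
    calc _ ≤ ∑ k : Fin (n + 1), if k = j then 0 else 2 := by
          refine Finset.sum_le_sum fun k _ => ?_
          split_ifs
          · simp
          · exact natDegree_mul_le.trans
              (Nat.add_le_add (natDegree_wtA (vs k)) (natDegree_wtB x y (vs k)))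
      _ = 2 * n := by
          simp [Fin.sum_univ_succAbove _ j, Fin.succAbove_ne, mul_comm]
  · rw [mem_degreeLT]
    exact lt_of_le_of_lt degree_C_le (by norm_num)

theorem natDegree_det_vandermonde_cons_le {n : ℕ} (us : Fin n → R) :
    (vandermonde (Fin.cons X fun i => C (us i) : Fin (n + 1) → R[X])).det.natDegree ≤ n := by
  rw [det_vandermonde_succ]
  have h : vandermonde (fun i : Fin n =>
      (Fin.cons X fun i => C (us i) : Fin (n + 1) → R[X]) i.succ) =
      C.mapMatrix (vandermonde us) := by
    ext1 i j; simp [vandermonde_apply]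
  rw [h, ← RingHom.map_det]
  refine (natDegree_mul_C_le _ _).trans ((natDegree_prod_le _ _).trans ?_)
  calc _ ≤ ∑ _ : Fin n, 1 := Finset.sum_le_sum fun i _ => by
        simp only [Fin.cons_succ, Fin.cons_zero]
        compute_degree
    _ = n := by simp

/-- The Izergin–Korepin formula at generic spectral parameters. -/
theorem izerginKorepin_of_generic {F : Type*} [Field F] (x y : F) {n : ℕ} (us vs : Fin n → F)
    (hu : Function.Injective us) (hv : Function.Injective vs) (hv0 : ∀ j, vs j ≠ 0)
    (huv : ∀ i j, us i * vs j ≠ 1) (hc : ∀ i j, crossDiag x y (vs i) (vs j) ≠ 0) :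
    IzerginKorepin x y us vs := by
  induction n with
  | zero => 
    have h : (fun _ : Fin 0 => false) = fun _ => true := Subsingleton.elim _ _
    simp [IzerginKorepin, partitionFn, columnsProd, h]
  | succ n ih =>
    set ut : Fin n → F := fun i => us i.succ with hut
    have htail : ∀ (a : F) (σ : Equiv.Perm (Fin (n + 1))), IzerginKorepin x y
        (fun i => (Fin.cons a ut : Fin (n + 1) → F) i.succ) fun j : Fin n => (vs ∘ σ) j.succ :=
      fun a σ => ih _ _
        (fun i j h => Fin.succ_injective _ (hu (by simpa [hut] using h)))
        (fun i j h => Fin.succ_injective _ (σ.injective (hv h)))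
        (fun j => hv0 _) (fun i j => by simpa [hut] using huv i.succ _) fun i j => hc _ _
    have hpoly : IzerginKorepin (C x) (C y)
        (Fin.cons X fun i => C (ut i) : Fin (n + 1) → F[X]) fun j => C (vs j) := by
      unfold IzerginKorepin
      -- Both sides have degree below `2 * n + 1` in the first row parameter, so `2 * n + 1` nodes
      -- suffice: the other row parameters, where both sides vanish, and the inverses of the column
      -- parameters, where the corner recursion applies after a permutation of columns.
      refine eq_of_degrees_lt_of_eval_index_eq (s := (Finset.univ : Finset (Fin n ⊕ Fin (n + 1))))
        (v := Sum.elim ut fun j => (vs j)⁻¹) ?_ ?_ ?_ ?_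
      · refine Function.Injective.injOn (Function.Injective.sumElim
          (fun i j h => Fin.succ_injective _ (hu h)) (fun i j h => hv (inv_injective h)) ?_)
        intro i j h
        exact huv i.succ j (by rw [show us i.succ = (vs j)⁻¹ from h, inv_mul_cancel₀ (hv0 j)])
      · rw [← mem_degreeLT]
        have hV : vandermonde (fun j => C (vs j)) = C.mapMatrix (vandermonde vs) := by
          ext1 i j; simp [vandermonde_apply]
        rw [hV, ← RingHom.map_det, mul_assoc, mul_comm]
        refine mul_mem_degreeLT (a := n)
          ((natDegree_mul_C_le _ _).trans (natDegree_det_vandermonde_cons_le ut))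
          (partitionFn_mem_degreeLT x y ut vs) ?_
        simp
      · rw [← mem_degreeLT]
        convert det_ikMatrix_mem_degreeLT x y ut vs using 2
        simp; ring
      · have key : ∀ a : F, IzerginKorepin x y (Fin.cons a ut : Fin (n + 1) → F) vs →
            eval a (partitionFn (C x) (C y) (Fin.cons X fun i => C (ut i) : Fin (n + 1) → F[X])
              (fun j => C (vs j)) *
              (vandermonde (Fin.cons X fun i => C (ut i) : Fin (n + 1) → F[X])).det *
              (vandermonde fun j => C (vs j)).det) =
            eval a (ikMatrix (C x) (C y) (Fin.cons X fun i => C (ut i) : Fin (n + 1) → F[X])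
              fun j => C (vs j)).det := by
          intro a h
          unfold IzerginKorepin at h
          have e1 : evalRingHom a ∘ (Fin.cons X fun i => C (ut i) : Fin (n + 1) → F[X]) =
              Fin.cons a ut := by
            funext i; refine Fin.cases ?_ (fun i => ?_) i <;> simp
          have e2 : (evalRingHom a ∘ fun j => C (vs j)) = vs := by
            funext j; simp
          simp only [← coe_evalRingHom, map_mul, RingHom.map_det, RingHom.mapMatrix_apply,
            map_partitionFn, map_ikMatrix, map_vandermonde, e1, e2]
          simpa using h
        rintro (i | j) -
        · exact key _ (IzerginKorepin.of_row_eq i rfl)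
        · refine key _ (IzerginKorepin.of_comp_perm hc (Equiv.swap 0 j)
            (IzerginKorepin.of_corner ?_ (htail _ _)))
          simp [hv0]
    have := hpoly.map (evalRingHom (us 0))
    have e1 : evalRingHom (us 0) ∘ (Fin.cons X fun i => C (ut i) : Fin (n + 1) → F[X]) = us := by
      funext i; refine Fin.cases ?_ (fun i => ?_) i <;> simp [hut]
    have e2 : (evalRingHom (us 0) ∘ fun j => C (vs j)) = vs := by
      funext j; simp
    rw [e1, e2] at this
    simpa using this

end IzerginKorepin

/-! ### Taylor coefficients of the reciprocal weights. -/

section Coefficients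

variable {R S : Type*} [CommRing R] [CommRing S]

/-- The coefficient of `u ^ i * v ^ j` in `1 / wtB x y u v`. -/
def binomCoeff (x y : R) (i j : ℕ) : R :=
  ∑ k ∈ Finset.range (min i j + 1), (i.choose k : R) * (j.choose k : R) * x ^ k * y ^ (i - k)

/-- The coefficient of `u ^ i * v ^ j` in `1 / (wtA u v * wtB x y u v)`. -/
def cauchyCoeff (x y : R) : ℕ → ℕ → R
  | 0, j => binomCoeff x y 0 j
  | i + 1, 0 => binomCoeff x y (i + 1) 0
  | i + 1, j + 1 => cauchyCoeff x y i j + binomCoeff x y (i + 1) (j + 1)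

theorem binomCoeff_eq_sum (x y : R) {i N : ℕ} (j : ℕ) (h : i < N) :
    binomCoeff x y i j =
      ∑ k ∈ Finset.range N, (i.choose k : R) * (j.choose k : R) * x ^ k * y ^ (i - k) := by
  refine Finset.sum_subset (fun k hk => ?_) fun k _ hk => ?_
  · simp only [Finset.mem_range] at *; omega
  · simp only [Finset.mem_range, not_lt] at hk
    rcases le_total i j with hij | hij
    · rw [Nat.choose_eq_zero_of_lt (by omega : i < k)]; simp
    · rw [Nat.choose_eq_zero_of_lt (by omega : j < k)]; simp

@[simp] theorem binomCoeff_zero_left (x y : R) (j : ℕ) : binomCoeff x y 0 j = 1 := by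
  simp [binomCoeff]

@[simp] theorem binomCoeff_zero_right (x y : R) (i : ℕ) : binomCoeff x y i 0 = y ^ i := by
  simp [binomCoeff]

theorem binomCoeff_succ_left (x y : R) (i j : ℕ) :
    binomCoeff x y (i + 1) j = y * binomCoeff x y i j + x * ∑ k ∈ Finset.range (i + 1),
      (i.choose k : R) * (j.choose (k + 1) : R) * x ^ k * y ^ (i - k) := by
  rw [binomCoeff_eq_sum x y j (Nat.lt_succ_self (i + 1)),
    binomCoeff_eq_sum x y j (show i < i + 1 + 1 by omega), Finset.sum_range_succ',
    Finset.sum_range_succ' _ (i + 1), mul_add, Finset.mul_sum, Finset.mul_sum, add_right_comm,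
    ← Finset.sum_add_distrib]
  congr 1
  · refine Finset.sum_congr rfl fun k hk => ?_
    rw [Nat.choose_succ_succ, Nat.cast_add, Nat.succ_sub_succ]
    rcases Nat.lt_or_ge k i with h | h
    · rw [show i - k = (i - (k + 1)) + 1 by omega]
      ring
    · rw [Nat.choose_eq_zero_of_lt (show i < k + 1 by omega)]
      push_cast; ring
  · simp [pow_succ']

/-- This is the recurrence obtained by comparing coefficients in `wtB * (1 / wtB) = 1`. -/
theorem binomCoeff_succ_succ (x y : R) (i j : ℕ) :
    binomCoeff x y (i + 1) (j + 1) =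
      y * binomCoeff x y i (j + 1) + binomCoeff x y (i + 1) j - (y - x) * binomCoeff x y i j := by
  rw [binomCoeff_succ_left x y i (j + 1), binomCoeff_succ_left x y i j]
  have h : ∑ k ∈ Finset.range (i + 1),
      (i.choose k : R) * ((j + 1).choose (k + 1) : R) * x ^ k * y ^ (i - k) =
      binomCoeff x y i j + ∑ k ∈ Finset.range (i + 1),
        (i.choose k : R) * (j.choose (k + 1) : R) * x ^ k * y ^ (i - k) := by
    rw [binomCoeff_eq_sum x y j (Nat.lt_succ_self i), ← Finset.sum_add_distrib]
    refine Finset.sum_congr rfl fun k _ => ?_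
    rw [Nat.choose_succ_succ, Nat.cast_add]
    ring
  rw [h]
  ring

theorem map_binomCoeff (f : R →+* S) (x y : R) (i j : ℕ) :
    f (binomCoeff x y i j) = binomCoeff (f x) (f y) i j := by
  simp [binomCoeff]

theorem map_cauchyCoeff (f : R →+* S) (x y : R) (i j : ℕ) :
    f (cauchyCoeff x y i j) = cauchyCoeff (f x) (f y) i j := by
  induction i generalizing j with
  | zero => simp [cauchyCoeff]
  | succ i ih => cases j <;> simp [cauchyCoeff, map_binomCoeff, ih]

/-- The array `e`, shifted down by one row. -/
def shiftRow (e : ℕ → ℕ → R) : ℕ → ℕ → R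
  | 0, _ => 0
  | i + 1, j => e i j

/-- The array `e`, shifted to the right by one column. -/
def shiftCol (e : ℕ → ℕ → R) : ℕ → ℕ → R
  | _, 0 => 0
  | i, j + 1 => e i j

@[simp] theorem shiftRow_zero (e : ℕ → ℕ → R) (j : ℕ) : shiftRow e 0 j = 0 := rfl

@[simp] theorem shiftRow_succ (e : ℕ → ℕ → R) (i j : ℕ) : shiftRow e (i + 1) j = e i j := rfl

@[simp] theorem shiftCol_zero (e : ℕ → ℕ → R) (i : ℕ) : shiftCol e i 0 = 0 := rfl

@[simp] theorem shiftCol_succ (e : ℕ → ℕ → R) (i j : ℕ) : shiftCol e i (j + 1) = e i j := rfl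

theorem mul_sum_range_shiftRow {N : ℕ} {u v : R} (hu : u ^ N = 0) (e : ℕ → ℕ → R) :
    u * ∑ k ∈ Finset.range N, ∑ l ∈ Finset.range N, e k l * u ^ k * v ^ l =
      ∑ k ∈ Finset.range N, ∑ l ∈ Finset.range N, shiftRow e k l * u ^ k * v ^ l := by
  have h := Finset.sum_range_succ'
    (fun k => ∑ l ∈ Finset.range N, shiftRow e k l * u ^ k * v ^ l) N
  rw [Finset.sum_range_succ] at h
  simp only [hu, mul_zero, zero_mul, Finset.sum_const_zero, add_zero, shiftRow_zero,
    shiftRow_succ] at h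
  rw [h, Finset.mul_sum]
  refine Finset.sum_congr rfl fun k _ => ?_
  rw [Finset.mul_sum]
  exact Finset.sum_congr rfl fun l _ => by ring

theorem mul_sum_range_shiftCol {N : ℕ} {u v : R} (hv : v ^ N = 0) (e : ℕ → ℕ → R) :
    v * ∑ k ∈ Finset.range N, ∑ l ∈ Finset.range N, e k l * u ^ k * v ^ l =
      ∑ k ∈ Finset.range N, ∑ l ∈ Finset.range N, shiftCol e k l * u ^ k * v ^ l := by
  rw [Finset.mul_sum]
  refine Finset.sum_congr rfl fun k _ => ?_
  have h := Finset.sum_range_succ' (fun l => shiftCol e k l * u ^ k * v ^ l) N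
  rw [Finset.sum_range_succ] at h
  simp only [hv, mul_zero, zero_mul, add_zero, shiftCol_zero, shiftCol_succ] at h
  rw [h, Finset.mul_sum]
  exact Finset.sum_congr rfl fun l _ => by ring

/-- Nilpotent `u` and `v` let a truncated sum serve as the full power series; multiplication by `u`
or `v` is a shift of the coefficient array. -/
theorem wtB_mul_sum_binomCoeff (x y : R) {N : ℕ} (hN : 0 < N) {u v : R} (hu : u ^ N = 0)
    (hv : v ^ N = 0) :
    wtB x y u v * ∑ k ∈ Finset.range N, ∑ l ∈ Finset.range N,
      binomCoeff x y k l * u ^ k * v ^ l = 1 := by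
  have h1 := mul_sum_range_shiftRow (v := v) hu (binomCoeff x y)
  have h2 := mul_sum_range_shiftCol (u := u) hv (binomCoeff x y)
  have h3 := mul_sum_range_shiftRow (v := v) hu (shiftCol (binomCoeff x y))
  have h4 : ∀ s : R, wtB x y u v * s = s - y * (u * s) - v * s + (y - x) * (u * (v * s)) :=
    fun s => by unfold wtB; ring
  rw [h4, h1, h2, h3]
  simp only [Finset.mul_sum, ← Finset.sum_sub_distrib, ← Finset.sum_add_distrib]
  have h5 : ∀ k l : ℕ, binomCoeff x y k l * u ^ k * v ^ l -
      y * (shiftRow (binomCoeff x y) k l * u ^ k * v ^ l) -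
      shiftCol (binomCoeff x y) k l * u ^ k * v ^ l +
      (y - x) * (shiftRow (shiftCol (binomCoeff x y)) k l * u ^ k * v ^ l) =
      if k = 0 then if l = 0 then 1 else 0 else 0 := by
    rintro (_ | k) (_ | l)
    · simp
    · simp
    · simp; ring
    · simp [binomCoeff_succ_succ]; ring
  simp only [h5]
  simp [hN]

theorem wt_mul_sum_cauchyCoeff (x y : R) {N : ℕ} (hN : 0 < N) {u v : R} (hu : u ^ N = 0)
    (hv : v ^ N = 0) :
    wtA u v * wtB x y u v * ∑ k ∈ Finset.range N, ∑ l ∈ Finset.range N,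
      cauchyCoeff x y k l * u ^ k * v ^ l = 1 := by
  rw [← wtB_mul_sum_binomCoeff x y hN hu hv, mul_comm (wtA u v), mul_assoc]
  congr 1
  have h2 := mul_sum_range_shiftCol (u := u) hv (cauchyCoeff x y)
  have h3 := mul_sum_range_shiftRow (v := v) hu (shiftCol (cauchyCoeff x y))
  rw [← h2, ← mul_assoc] at h3
  rw [wtA, sub_mul, one_mul, h3]
  simp only [← Finset.sum_sub_distrib]
  refine Finset.sum_congr rfl fun k _ => Finset.sum_congr rfl fun l _ => ?_
  rcases k with _ | k <;> rcases l with _ | l <;> simp [cauchyCoeff]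
  ring

end Coefficients

/-! ### The homogeneous limit of the determinant. -/

section HomogeneousLimit

open Polynomial Matrix

variable {F : Type*} [Field F]

/-- Over `F` the rectangular matrix of powers of `α` is the square Vandermonde matrix times some `H`
whose first `n` columns form the identity. Rescaling by `X` turns `H m k` into `H m k * X ^ (k -
m)`, and only the identity block survives at `X = 0`. -/
theorem exists_vandermonde_factor {n N : ℕ} (hn : n ≤ N) {α : Fin n → F}
    (hα : Function.Injective α) :
    ∃ B : Matrix (Fin n) (Fin N) F[X],
      (of fun i (k : Fin N) => (C (α i) * X) ^ (k : ℕ)) =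
        vandermonde (fun i => C (α i) * X) * B ∧
      B.map constantCoeff = of fun m k => if k = Fin.castLE hn m then 1 else 0 := by
  have hdet : IsUnit (vandermonde α).det := (det_vandermonde_ne_zero_iff.2 hα).isUnit
  set A : Matrix (Fin n) (Fin N) F := of fun i k => α i ^ (k : ℕ) with hA
  set H := (vandermonde α)⁻¹ * A with hH
  have hVH : vandermonde α * H = A := mul_nonsing_inv_cancel_left _ _ hdet
  have hlow : ∀ (m : Fin n) (k : Fin N), (k : ℕ) < n → H m k = if (m : ℕ) = k then 1 else 0 := by
    intro m k hk
    have h1 : (A.submatrix id (Fin.castLE hn)) = vandermonde α := by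
      ext i j; simp [hA, vandermonde_apply]
    have h2 : H.submatrix id (Fin.castLE hn) = 1 := by
      change (vandermonde α)⁻¹ * A.submatrix id (Fin.castLE hn) = 1
      rw [h1, nonsing_inv_mul _ hdet]
    have h3 := congrFun₂ h2 m ⟨k, hk⟩
    rw [submatrix_apply, one_apply] at h3
    simpa [Fin.ext_iff] using h3
  refine ⟨of fun m k => C (H m k) * X ^ ((k : ℕ) - (m : ℕ)), ?_, ?_⟩
  · ext1 i k
    have h := congrFun₂ hVH i k
    simp only [mul_apply, vandermonde_apply, hA, of_apply] at h ⊢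
    rw [mul_pow, ← C_pow, ← h, map_sum, Finset.sum_mul]
    refine Finset.sum_congr rfl fun m _ => ?_
    -- For `k < m` the truncated exponent `k - m` is harmless because `H m k = 0`.
    rcases Nat.lt_or_ge k m with hkm | hkm
    · rw [hlow m k (by omega), if_neg (by omega)]; simp
    · rw [mul_pow, show X ^ (k : ℕ) = (X : F[X]) ^ (m : ℕ) * X ^ ((k : ℕ) - (m : ℕ)) by
        rw [← pow_add]; congr 1; omega]
      simp only [map_mul, map_pow]; ring
  · ext m k
    simp only [map_apply, of_apply, map_mul, map_pow, constantCoeff_apply, coeff_C_zero,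
      coeff_X_zero, Fin.ext_iff, Fin.val_castLE]
    rcases lt_trichotomy (k : ℕ) m with hkm | hkm | hkm
    · rw [hlow m k (by omega), if_neg (by omega), if_neg (by omega)]; simp
    · rw [hlow m k (by omega), if_pos hkm.symm, if_pos hkm]; simp [hkm]
    · rw [if_neg (by omega), zero_pow (by omega), mul_zero]

/-- These parameters are generic in the fraction field of `F[X]`; at `X = 0` the weight `crossDiag`
equals `y`, hence the condition on `y`. -/
theorem izerginKorepin_X [CharZero F] (x y : F) (hy : y ≠ 0) (n : ℕ) :
    IzerginKorepin (C x) (C y) (fun i : Fin n => C ((i : F) + 1) * X)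
      fun i : Fin n => C ((i : F) + 1) * X := by
  have hinj : Function.Injective fun i : Fin n => (C ((i : F) + 1) * X : F[X]) := by
    intro i j h
    have := congrArg (eval 1) h
    simpa [Fin.ext_iff] using this
  have hf := IsFractionRing.injective F[X] (FractionRing F[X])
  rw [← izerginKorepin_map_iff hf]
  refine izerginKorepin_of_generic _ _ _ _ (hf.comp hinj) (hf.comp hinj) ?_ ?_ ?_
  · intro j h
    rw [Function.comp_apply, ← map_zero (algebraMap F[X] (FractionRing F[X]))] at h
    have := congrArg (eval 1) (hf h)
    simp [Nat.cast_add_one_ne_zero] at this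
  · intro i j h
    rw [Function.comp_apply, Function.comp_apply, ← map_mul,
      ← map_one (algebraMap F[X] (FractionRing F[X]))] at h
    have := congrArg (eval 0) (hf h)
    simp at this
  · intro i j h
    have h' : algebraMap F[X] (FractionRing F[X]) (crossDiag (C x) (C y) (C ((i : F) + 1) * X)
        (C ((j : F) + 1) * X)) = algebraMap F[X] (FractionRing F[X]) 0 := by
      rw [map_zero, ← h]; simp [crossDiag]
    have := congrArg (eval 0) (hf h')
    simp [crossDiag] at this
    exact hy this

/-- Modulo `r` the parameters are nilpotent, so each `1 / (wtA * wtB)` is its truncated double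
series, and the matrix of these series is a product of three matrices. -/
theorem dvd_det_ikMatrix_sub {R : Type*} [CommRing R] (x y : R) {n N : ℕ} (hN : 0 < N)
    {us vs : Fin n → R} {r : R} (hu : ∀ i, r ∣ us i ^ N) (hv : ∀ i, r ∣ vs i ^ N) :
    r ∣ (ikMatrix x y us vs).det - (∏ i, ∏ k, wtA (us i) (vs k) * wtB x y (us i) (vs k)) *
      ((of fun i (k : Fin N) => us i ^ (k : ℕ)) *
        (of fun k l : Fin N => cauchyCoeff x y k l) *
        (of fun i (k : Fin N) => vs i ^ (k : ℕ))ᵀ).det := by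
  rw [← Ideal.mem_span_singleton, ← Ideal.Quotient.eq_zero_iff_mem, map_sub, sub_eq_zero, map_mul,
    RingHom.map_det, RingHom.map_det, map_prod, ← det_mul_column]
  congr 1
  ext1 i j
  set q := Ideal.Quotient.mk (Ideal.span {r})
  have hq : ∀ a, r ∣ a → q a = 0 := fun a ha =>
    Ideal.Quotient.eq_zero_iff_mem.2 (Ideal.mem_span_singleton.2 ha)
  have key := wt_mul_sum_cauchyCoeff (q x) (q y) hN (u := q (us i)) (v := q (vs j))
    (by rw [← map_pow]; exact hq _ (hu i)) (by rw [← map_pow]; exact hq _ (hv j))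
  have hκ : q (((of fun i (k : Fin N) => us i ^ (k : ℕ)) *
        (of fun k l : Fin N => cauchyCoeff x y k l) *
        (of fun i (k : Fin N) => vs i ^ (k : ℕ))ᵀ) i j) =
      ∑ k ∈ Finset.range N, ∑ l ∈ Finset.range N,
        cauchyCoeff (q x) (q y) k l * q (us i) ^ k * q (vs j) ^ l := by
    simp only [mul_apply, of_apply, transpose_apply, Finset.sum_mul, map_sum, map_mul, map_pow,
      map_cauchyCoeff, Finset.sum_range]
    rw [Finset.sum_comm]
    exact Finset.sum_congr rfl fun k _ => Finset.sum_congr rfl fun l _ => by ring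
  have hprod : ∏ k, wtA (us i) (vs k) * wtB x y (us i) (vs k) =
      wtA (us i) (vs j) * wtB x y (us i) (vs j) * ikMatrix x y us vs i j := by
    rw [← Finset.mul_prod_erase _ _ (Finset.mem_univ j)]
    congr 1
    simp only [ikMatrix, of_apply]
    rw [← Finset.mul_prod_erase Finset.univ (fun k => if k = j then 1 else _) (Finset.mem_univ j),
      if_pos rfl, one_mul]
    exact Finset.prod_congr rfl fun k hk => by rw [if_neg (Finset.ne_of_mem_erase hk)]
  have hw : q (wtA (us i) (vs j) * wtB x y (us i) (vs j)) =
      wtA (q (us i)) (q (vs j)) * wtB (q x) (q y) (q (us i)) (q (vs j)) := by simp [wtA, wtB]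
  rw [← hκ, ← hw] at key
  simp only [RingHom.mapMatrix_apply, map_apply, of_apply]
  rw [hprod, map_mul]
  linear_combination (- q (ikMatrix x y us vs i j)) * key

theorem partitionFn_zero_eq_det [CharZero F] (x y : F) (hy : y ≠ 0) (n : ℕ) :
    partitionFn x y (fun _ : Fin n => 0) (fun _ : Fin n => 0) =
      (of fun i j : Fin n => cauchyCoeff x y i j).det := by
  set α : Fin n → F := fun i => (i : F) + 1 with hα
  have hinj : Function.Injective α := fun i j h => by simpa [hα, Fin.ext_iff] using h
  set u : Fin n → F[X] := fun i => C (α i) * X with hu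
  set M : ℕ := ∑ i : Fin n, (i : ℕ) with hM
  -- The two Vandermonde determinants together have order `2 * M` in `X`; the precision must exceed
  -- this for the constant term to survive cancellation.
  set N : ℕ := 2 * M + n + 1 with hN
  have hnN : n ≤ N := by omega
  obtain ⟨B, hB, hB0⟩ := exists_vandermonde_factor hnN hinj
  have hik : IzerginKorepin (C x) (C y) u u := izerginKorepin_X x y hy n
  have hdvd : ∀ i, X ^ N ∣ u i ^ N := fun i => by
    rw [hu, mul_pow]; exact Dvd.intro_left _ rfl
  have h := dvd_det_ikMatrix_sub (C x) (C y) (by omega) hdvd hdvd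
  rw [← hik, show (of fun i (k : Fin N) => u i ^ (k : ℕ)) = vandermonde u * B from hB] at h
  have hV : (vandermonde u).det = C (vandermonde α).det * X ^ M := by
    have : vandermonde u = of fun i (j : Fin n) => X ^ (j : ℕ) * C.mapMatrix (vandermonde α) i j := by
      ext1 i j
      simp [vandermonde_apply, hu]; ring
    rw [this, det_mul_row, Finset.prod_pow_eq_pow_sum, ← RingHom.map_det, mul_comm]
  have hc : (vandermonde α).det ≠ 0 := det_vandermonde_ne_zero_iff.2 hinj
  set K := (of fun k l : Fin N => cauchyCoeff (C x) (C y) k l) with hK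
  rw [transpose_mul, show vandermonde u * B * K * (Bᵀ * (vandermonde u)ᵀ) =
    vandermonde u * (B * K * Bᵀ) * (vandermonde u)ᵀ by simp only [Matrix.mul_assoc], det_mul,
    det_mul, det_transpose, hV] at h
  set Z := partitionFn (C x) (C y) u u with hZ
  set W := ∏ i, ∏ k, wtA (u i) (u k) * wtB (C x) (C y) (u i) (u k) with hW
  have h1 : X ^ (2 * M) * X ∣ X ^ (2 * M) * (C ((vandermonde α).det ^ 2) *
      (Z - W * (B * K * Bᵀ).det)) := by
    refine (Dvd.intro (X ^ n) ?_).trans (h.trans (dvd_of_eq ?_))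
    · rw [hN]; ring
    · rw [C_pow]; ring
  have h2 := (mul_dvd_mul_iff_left (pow_ne_zero _ X_ne_zero)).1 h1
  rw [X_dvd_iff, coeff_C_mul, mul_eq_zero, or_iff_right (pow_ne_zero _ hc),
    ← constantCoeff_apply, map_sub, sub_eq_zero, map_mul] at h2
  have hu0 : ∀ i, constantCoeff (u i) = 0 := fun i => by simp [hu]
  have hZ0 : constantCoeff Z = partitionFn x y (fun _ : Fin n => 0) fun _ : Fin n => 0 := by
    rw [hZ, map_partitionFn, show constantCoeff ∘ u = fun _ => 0 from funext hu0]
    simp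
  have hW0 : constantCoeff W = 1 := by
    rw [hW, map_prod]
    refine Finset.prod_eq_one fun i _ => ?_
    rw [map_prod]
    refine Finset.prod_eq_one fun k _ => ?_
    simp [wtA, wtB, hu0, -constantCoeff_apply]
  rw [← hZ0, h2, hW0, one_mul, RingHom.map_det]
  congr 1
  have hK0 : K.map constantCoeff = of fun k l : Fin N => cauchyCoeff x y k l := by
    ext k l
    rw [hK, map_apply, of_apply, map_cauchyCoeff]
    simp
  rw [RingHom.mapMatrix_apply, Matrix.map_mul, Matrix.map_mul, hK0, transpose_map, hB0]
  ext i j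
  simp [mul_apply]

end HomogeneousLimit

/-! ### ASMs in terms of partial sums equal to `0` or `1`. -/

section PartialSums

/-- The sum of the first `m` terms of `f`. -/
def partialSum {n : ℕ} (f : Fin n → ℤ) (m : ℕ) : ℤ := ∑ j : Fin n with j.val < m, f j

variable {n : ℕ}

@[simp] theorem partialSum_zero (f : Fin n → ℤ) : partialSum f 0 = 0 := by simp [partialSum]

theorem partialSum_succ (f : Fin n → ℤ) (j : Fin n) :
    partialSum f (j + 1) = partialSum f j + f j := by
  have : (Finset.univ.filter fun k : Fin n => (k : ℕ) < j + 1) =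
      insert j (Finset.univ.filter fun k : Fin n => (k : ℕ) < j) := by
    ext k; simp [Fin.ext_iff]; omega
  rw [partialSum, this, Finset.sum_insert (by simp), add_comm, partialSum]

theorem partialSum_of_le (f : Fin n → ℤ) {m : ℕ} (h : n ≤ m) : partialSum f m = ∑ j, f j := by
  rw [partialSum, Finset.filter_true_of_mem]
  intro j _; omega

theorem partialSum_succ' (f : Fin (n + 1) → ℤ) (m : ℕ) :
    partialSum f (m + 1) = f 0 + partialSum (fun i => f i.succ) m := by
  simp [partialSum, Finset.sum_filter, Fin.sum_univ_succ]

theorem partialSum_add_rev (f : Fin n → ℤ) {m : ℕ} (hm : m ≤ n) :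
    partialSum f m + partialSum (fun j => f j.rev) (n - m) = ∑ j, f j := by
  rw [← Finset.sum_filter_add_sum_filter_not Finset.univ fun j : Fin n => (j : ℕ) < m]
  congr 1
  rw [partialSum, Finset.sum_filter, Finset.sum_filter]
  refine Fintype.sum_equiv Fin.revPerm _ _ fun j => ?_
  have : (j : ℕ) < n - m ↔ ¬ ((Fin.revPerm j : Fin n) : ℕ) < m := by
    rw [Fin.revPerm_apply, Fin.val_rev]; omega
  simp only [this]
  rfl

theorem Alternates.rev {f : Fin n → ℤ} (hf : Alternates f) : Alternates fun j => f j.rev := by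
  intro j j' hj h h' hz
  have := hf j'.rev j.rev (Fin.rev_lt_rev.2 hj) h' h fun k h1 h2 => by
    simpa using hz k.rev (by rwa [← Fin.rev_lt_rev, Fin.rev_rev])
      (by rwa [← Fin.rev_lt_rev, Fin.rev_rev])
  show f j'.rev = - f j.rev
  rw [this, neg_neg]

/-- Initial sums and, by reversal, final sums are nonnegative, and together they add up to `1`. -/
theorem Alternates.partialSum_eq_zero_or_one {f : Fin n → ℤ} (hf : Alternates f)
    (he : ∀ j, f j = 0 ∨ f j = 1 ∨ f j = -1) (hs : ∑ j, f j = 1) (m : ℕ) :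
    partialSum f m = 0 ∨ partialSum f m = 1 := by
  rcases le_total m n with hm | hm
  · have h1 : 0 ≤ partialSum f m := hf.sum_nonneg he hs m
    have h2 : 0 ≤ partialSum (fun j => f j.rev) (n - m) :=
      hf.rev.sum_nonneg (fun j => he _) ((Equiv.sum_comp Fin.revPerm f).trans hs) _
    have h3 := partialSum_add_rev f hm
    omega
  · right; rw [partialSum_of_le f hm, hs]

theorem alternates_of_partialSum {f : Fin n → ℤ}
    (h : ∀ m ≤ n, partialSum f m = 0 ∨ partialSum f m = 1) : Alternates f := by
  intro j j' hj hj0 hj0' hz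
  have hlt : (j : ℕ) < j' := hj
  have key : ∀ d : ℕ, (j : ℕ) + 1 + d ≤ j' → partialSum f (j + 1 + d) = partialSum f (j + 1) := by
    intro d
    induction d with
    | zero => intro _; rfl
    | succ d ih =>
      intro hd
      have := partialSum_succ f ⟨j + 1 + d, by omega⟩
      rw [← add_assoc, this, ih (by omega),
        hz _ (Fin.lt_def.2 (by simp; omega)) (Fin.lt_def.2 (by simp; omega)), add_zero]
  have h1 := key (j' - (j + 1)) (by omega)
  rw [show (j : ℕ) + 1 + (j' - (j + 1)) = j' by omega] at h1
  have h2 := partialSum_succ f j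
  have h3 := partialSum_succ f j'
  have h4 := h j (by omega)
  have h5 := h (j + 1) (by omega)
  have h6 := h (j' + 1) (by omega)
  omega

theorem isASM_of_partialSum {A : Matrix (Fin n) (Fin n) ℤ}
    (hr : ∀ i, ∀ m ≤ n, partialSum (fun j => A i j) m = 0 ∨ partialSum (fun j => A i j) m = 1)
    (hc : ∀ j, ∀ m ≤ n, partialSum (fun i => A i j) m = 0 ∨ partialSum (fun i => A i j) m = 1)
    (hrs : ∀ i, ∑ j, A i j = 1) (hcs : ∀ j, ∑ i, A i j = 1) : IsASM A where
  entry i j := by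
    have h1 := partialSum_succ (fun j => A i j) j
    have h2 := hr i j (by omega)
    have h3 := hr i (j + 1) (by omega)
    omega
  row_alternates i := alternates_of_partialSum (hr i)
  col_alternates j := alternates_of_partialSum (hc j)
  row_sum := hrs
  col_sum := hcs

theorem IsASM.partialSum_row {A : Matrix (Fin n) (Fin n) ℤ} (hA : IsASM A) (i : Fin n) (m : ℕ) :
    partialSum (fun j => A i j) m = 0 ∨ partialSum (fun j => A i j) m = 1 :=
  (hA.row_alternates i).partialSum_eq_zero_or_one (hA.entry i) (hA.row_sum i) m

theorem IsASM.partialSum_col {A : Matrix (Fin n) (Fin n) ℤ} (hA : IsASM A) (j : Fin n) (m : ℕ) :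
    partialSum (fun i => A i j) m = 0 ∨ partialSum (fun i => A i j) m = 1 :=
  (hA.col_alternates j).partialSum_eq_zero_or_one (fun i => hA.entry i j) (hA.col_sum j) m

/-- This makes `ν` local: it sums, over positions, the column sum strictly above times the row sum
up to and including the entry. Both are `1` only at a zero entry whose left and top edges are `1`.
-/
theorem IsASM.nu_eq_card {A : Matrix (Fin n) (Fin n) ℤ} (hA : IsASM A) :
    nu A = (Finset.univ.filter fun p : Fin n × Fin n => partialSum (fun j => A p.1 j) p.2 = 1 ∧
      partialSum (fun i => A i p.2) p.1 = 1 ∧ A p.1 p.2 = 0).card := by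
  have h : nuInt A = ∑ i' : Fin n, ∑ j : Fin n,
      partialSum (fun i => A i j) i' * partialSum (fun j' => A i' j') (j + 1) := by
    unfold nuInt partialSum
    rw [Finset.sum_comm]
    refine Finset.sum_congr rfl fun i' _ => ?_
    rw [Finset.sum_comm]
    refine Finset.sum_congr rfl fun j _ => ?_
    rw [Finset.sum_filter, Finset.sum_filter, Finset.sum_mul_sum]
    refine Finset.sum_congr rfl fun i _ => Finset.sum_congr rfl fun j' _ => ?_
    have h1 : i < i' ↔ (i : ℕ) < (i' : ℕ) := Iff.rfl
    have h2 : j' ≤ j ↔ (j' : ℕ) < (j : ℕ) + 1 := Nat.lt_succ_iff.symm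
    simp only [h1, h2]
    by_cases a : (i : ℕ) < (i' : ℕ) <;> by_cases b : (j' : ℕ) < (j : ℕ) + 1 <;> simp [a, b]
  have h' : (nu A : ℤ) = ((Finset.univ.filter fun p : Fin n × Fin n =>
      partialSum (fun j => A p.1 j) p.2 = 1 ∧ partialSum (fun i => A i p.2) p.1 = 1 ∧
        A p.1 p.2 = 0).card : ℤ) := by
    rw [coe_nu hA, h, Finset.card_filter, Nat.cast_sum, Fintype.sum_prod_type]
    refine Finset.sum_congr rfl fun i _ => Finset.sum_congr rfl fun j _ => ?_
    have h1 := partialSum_succ (fun j => A i j) j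
    have h2 := partialSum_succ (fun i => A i j) i
    have h3 := hA.partialSum_row i j
    have h4 := hA.partialSum_row i (j + 1)
    have h5 := hA.partialSum_col j i
    have h6 := hA.partialSum_col j (i + 1)
    rcases h3 with h3 | h3 <;> rcases h4 with h4 | h4 <;> rcases h5 with h5 | h5 <;>
      rcases h6 with h6 | h6 <;> simp only [h3, h4, h5, h6] at h1 h2 ⊢ <;> simp <;> omega
  exact_mod_cast h'

end PartialSums

/-! ### Matrix powers as sums over paths. -/

section Paths

variable {R : Type*} [CommRing R]

/-- The entries of the power of a matrix as sums over paths. -/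
theorem pow_apply_eq_sum_paths {ι : Type*} [Fintype ι] [DecidableEq ι] (M : Matrix ι ι R) (n : ℕ)
    (s t : ι) :
    (M ^ n) s t = ∑ p : Fin (n + 1) → ι,
      if p 0 = s ∧ p (Fin.last n) = t then ∏ j : Fin n, M (p j.castSucc) (p j.succ) else 0 := by
  induction n generalizing s with
  | zero =>
    rw [← (Equiv.funUnique (Fin 1) ι).symm.sum_comp]
    simp only [pow_zero, Matrix.one_apply, Equiv.funUnique_symm_apply, uniqueElim_const,
      Finset.univ_eq_empty, Finset.prod_empty]
    by_cases h : s = t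
    · subst h; simp
    · rw [if_neg h]
      symm
      refine Finset.sum_eq_zero fun i _ => if_neg ?_
      rintro ⟨rfl, rfl⟩; exact h rfl
  | succ n ih =>
    rw [pow_succ', Matrix.mul_apply]
    simp only [ih, Finset.mul_sum]
    conv_rhs => rw [sum_fin_succ_pi, Finset.sum_comm]
    rw [Finset.sum_comm]
    refine Finset.sum_congr rfl fun p _ => ?_
    simp only [Fin.cons_zero, ← Fin.succ_last, Fin.cons_succ, Fin.prod_univ_succ,
      Fin.castSucc_zero, ← Fin.succ_castSucc]
    rw [Finset.sum_eq_single (p 0) (fun b _ hb => by simp [hb.symm]) (by simp),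
      Finset.sum_eq_single s (fun b _ hb => by simp [hb]) (by simp)]
    by_cases h : p (Fin.last n) = t <;> simp [h]

end Paths

/-! ### From the partition function at zero parameters to ASMs. -/

section Expansion

variable {R : Type*} [CommRing R]

/-- The value `0` or `1` of an edge. -/
def edgeVal (b : Bool) : ℤ := if b then 1 else 0

theorem edgeVal_eq (b : Bool) : edgeVal b = 0 ∨ edgeVal b = 1 := by cases b <;> simp [edgeVal]

@[simp] theorem edgeVal_false : edgeVal false = 0 := rfl

@[simp] theorem edgeVal_true : edgeVal true = 1 := rfl

theorem decide_edgeVal (b : Bool) : decide (edgeVal b = 1) = b := by cases b <;> rfl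

theorem edgeVal_decide {a : ℤ} (h : a = 0 ∨ a = 1) : edgeVal (decide (a = 1)) = a := by
  rcases h with rfl | rfl <;> simp

/-- The weight of an entry `e` of an alternating sign matrix, if the entries to the left of it
have sum `p` and those above it have sum `q`. -/
def entryWt (x y : R) (p q e : ℤ) : R :=
  if (p = 0 ∨ p = 1) ∧ (q = 0 ∨ q = 1) ∧ (p + e = 0 ∨ p + e = 1) ∧ (q + e = 0 ∨ q + e = 1) then
    (if p = 1 ∧ q = 1 ∧ e = 0 then x else 1) * (if e = -1 then y else 1)
  else 0

/-- A nonzero vertex weight forces equal increments horizontally and vertically, so the horizontal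
edges determine all vertical ones as partial sums. -/
theorem columnMatrix_zero_apply (x y : R) {m : ℕ} (t b : Bool) (h h' : Fin m → Bool) :
    columnMatrix x y (fun _ => 0) 0 t b h h' =
      if edgeVal t + ∑ i, (edgeVal (h' i) - edgeVal (h i)) = edgeVal b then
        ∏ i : Fin m, entryWt x y (edgeVal (h i))
          (edgeVal t + partialSum (fun i => edgeVal (h' i) - edgeVal (h i)) i)
          (edgeVal (h' i) - edgeVal (h i))
      else 0 := by
  induction m generalizing t with
  | zero => cases t <;> cases b <;> simp [columnMatrix]
  | succ m ih =>
    have ih' := fun k => ih k (Fin.tail h) (Fin.tail h')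
    have ht : Fin.tail (fun _ : Fin (m + 1) => (0 : R)) = fun _ => 0 := rfl
    simp only [columnMatrix, Matrix.of_apply, ht, ih', Fintype.sum_bool, Fin.sum_univ_succ,
      Fin.prod_univ_succ, Fin.val_zero, Fin.val_succ, partialSum_zero, partialSum_succ', Fin.tail,
      ← add_assoc]
    generalize h 0 = k
    generalize h' 0 = k'
    cases k <;> cases k' <;> cases t <;>
      simp [vertexWt, entryWt, wtA, wtB, wtG, wtH]

theorem partitionFn_zero_eq_sum_paths (x y : R) (n : ℕ) :
    partitionFn x y (fun _ : Fin n => 0) (fun _ : Fin n => 0) =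
      ∑ H : Fin (n + 1) → Fin n → Bool,
        if H 0 = (fun _ => false) ∧ H (Fin.last n) = (fun _ => true) then
          ∏ j : Fin n,
            if ∑ i, (edgeVal (H j.succ i) - edgeVal (H j.castSucc i)) = 1 then
              ∏ i : Fin n, entryWt x y (edgeVal (H j.castSucc i))
                (partialSum (fun i => edgeVal (H j.succ i) - edgeVal (H j.castSucc i)) i)
                (edgeVal (H j.succ i) - edgeVal (H j.castSucc i))
            else 0
        else 0 := by
  rw [partitionFn, columnsProd, List.ofFn_const, List.map_replicate, List.prod_replicate,
    pow_apply_eq_sum_paths]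
  simp only [columnMatrix_zero_apply, edgeVal_false, edgeVal_true, zero_add]

theorem IsASM.prod_entryWt {n : ℕ} {A : Matrix (Fin n) (Fin n) ℤ} (hA : IsASM A) (x y : R) :
    ∏ j : Fin n, ∏ i : Fin n, entryWt x y (partialSum (fun j => A i j) j)
      (partialSum (fun i => A i j) i) (A i j) = x ^ nu A * y ^ mu A := by
  rw [hA.nu_eq_card, mu, Finset.prod_comm, ← Finset.prod_const, ← Finset.prod_const,
    Finset.prod_filter, Finset.prod_filter, ← Finset.prod_mul_distrib, Fintype.prod_prod_type]
  refine Finset.prod_congr rfl fun i _ => Finset.prod_congr rfl fun j _ => ?_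
  rw [entryWt, if_pos]
  refine ⟨hA.partialSum_row i j, hA.partialSum_col j i, ?_, ?_⟩
  · have := partialSum_succ (fun j => A i j) j
    rw [← this]; exact hA.partialSum_row i (j + 1)
  · have := partialSum_succ (fun i => A i j) i
    rw [← this]; exact hA.partialSum_col j (i + 1)

/-- The generating function of alternating sign matrices is a partition function of the
six-vertex model. -/
theorem ZASM_one_eq_partitionFn (n : ℕ) (x y : R) :
    ZASM n x y 1 = partitionFn x y (fun _ : Fin n => 0) fun _ : Fin n => 0 := by
  rw [partitionFn_zero_eq_sum_paths, ZASM]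
  have hval : ∀ A ∈ ASM n, ∀ (j : Fin (n + 1)) (i : Fin n),
      edgeVal (decide (partialSum (fun j => A i j) j = 1)) = partialSum (fun j => A i j) j :=
    fun A hA j i => edgeVal_decide (((mem_ASM A).1 hA).partialSum_row i j)
  have hdiff : ∀ A ∈ ASM n, ∀ (j i : Fin n),
      edgeVal (decide (partialSum (fun j => A i j) j.succ = 1)) -
        edgeVal (decide (partialSum (fun j => A i j) j.castSucc = 1)) = A i j := by
    intro A hA j i
    rw [hval A hA j.succ i, hval A hA j.castSucc i, Fin.val_succ, Fin.val_castSucc,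
      partialSum_succ, add_sub_cancel_left]
  -- An ASM is sent to its horizontal edges, the row partial sums; edge configurations that do not
  -- come from an ASM have weight `0`.
  refine Finset.sum_of_injOn
    (fun A j i => decide (partialSum (fun j => A i j) (j : ℕ) = 1)) ?_ (by simp [Set.MapsTo]) ?_ ?_
  · intro A hA B hB hAB
    ext i j
    rw [← hdiff A hA, ← hdiff B hB]
    have h1 := congrFun₂ hAB j.succ i
    have h2 := congrFun₂ hAB j.castSucc i
    simp only at h1 h2
    rw [h1, h2]
  · intro H _ hH
    by_contra hne
    refine hH ?_
    rw [ite_eq_right_iff, Classical.not_imp] at hne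
    obtain ⟨⟨h0, hlast⟩, hprod⟩ := hne
    set A : Matrix (Fin n) (Fin n) ℤ :=
      Matrix.of fun i j => edgeVal (H j.succ i) - edgeVal (H j.castSucc i) with hA
    have hrow : ∀ i (m : ℕ) (hm : m < n + 1),
        partialSum (fun j => A i j) m = edgeVal (H ⟨m, hm⟩ i) := by
      intro i m
      induction m with
      | zero => intro hm; rw [partialSum_zero, show (⟨0, hm⟩ : Fin (n + 1)) = 0 from rfl, h0]; rfl
      | succ m ih =>
        intro hm
        have := partialSum_succ (fun j => A i j) ⟨m, by omega⟩
        rw [this, ih (by omega)]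
        simp [hA]
    have hcol : ∀ j, ∑ i, A i j = 1 ∧ ∀ i, entryWt x y (edgeVal (H j.castSucc i))
        (partialSum (fun i => A i j) i) (A i j) ≠ 0 := by
      intro j
      have hj' : ¬ _ = _ := fun h => hprod (Finset.prod_eq_zero (Finset.mem_univ j) h)
      rw [ite_eq_right_iff, Classical.not_imp] at hj'
      exact ⟨hj'.1, fun i h => hj'.2 (Finset.prod_eq_zero (Finset.mem_univ i) h)⟩
    have hASM : IsASM A := by
      refine isASM_of_partialSum (fun i m hm => ?_) (fun j m hm => ?_) (fun i => ?_)
        fun j => (hcol j).1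
      · rw [hrow i m (by omega)]; exact edgeVal_eq _
      · rcases hm.lt_or_eq with hm | rfl
        · by_contra hq
          refine (hcol j).2 ⟨m, hm⟩ (if_neg fun h => hq h.2.1)
        · right; rw [partialSum_of_le _ le_rfl, (hcol j).1]
      · rw [← partialSum_of_le _ le_rfl, hrow i n (by omega),
          show (⟨n, by omega⟩ : Fin (n + 1)) = Fin.last n from rfl, hlast]
        rfl
    refine ⟨A, (mem_ASM A).2 hASM, ?_⟩
    funext j i
    simp only
    rw [hrow i j j.isLt, decide_edgeVal]
  · intro A hA
    have hA' := (mem_ASM A).1 hA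
    simp only [hdiff A hA, one_pow, mul_one]
    rw [if_pos, ← hA'.prod_entryWt x y]
    · refine Finset.prod_congr rfl fun j _ => ?_
      rw [if_pos (hA'.col_sum j)]
      refine Finset.prod_congr rfl fun i _ => ?_
      rw [hval A hA j.castSucc i]
      rfl
    · constructor
      · funext i; simp
      · funext i; simp [partialSum_of_le _ le_rfl, hA'.row_sum i]

end Expansion

/-! ### Universal identity and reduction to `MASM`. -/

section Determinant

open Matrix

variable {R : Type*} [CommRing R]

theorem map_det_cauchyCoeff {S : Type*} [CommRing S] (f : R →+* S) (x y : R) (n : ℕ) :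
    f (of fun i j : Fin n => cauchyCoeff x y i j).det =
      (of fun i j : Fin n => cauchyCoeff (f x) (f y) i j).det := by
  rw [RingHom.map_det]
  congr 1
  ext i j
  simp [map_cauchyCoeff]

theorem map_partitionFn_zero {S : Type*} [CommRing S] (f : R →+* S) (x y : R) (n : ℕ) :
    f (partitionFn x y (fun _ : Fin n => 0) fun _ : Fin n => 0) =
      partitionFn (f x) (f y) (fun _ : Fin n => 0) fun _ : Fin n => 0 := by
  rw [map_partitionFn]
  congr 1 <;> funext i <;> simp

/-- The determinant formula for the generating function, in terms of the coefficients of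
`1 / (wtA u v * wtB x y u v)`. -/
theorem ZASM_one_eq_det_cauchyCoeff (n : ℕ) (x y : R) :
    ZASM n x y 1 = (of fun i j : Fin n => cauchyCoeff x y i j).det := by
  rw [ZASM_one_eq_partitionFn]
  -- Both sides are compatible with ring homomorphisms, so it suffices to treat indeterminate `x,
  -- y`, where the fraction field has characteristic zero and `y ≠ 0`.
  set P := MvPolynomial (Fin 2) ℤ
  have huniv : partitionFn (MvPolynomial.X 0 : P) (MvPolynomial.X 1) (fun _ : Fin n => 0)
      (fun _ : Fin n => 0) = (of fun i j : Fin n =>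
        cauchyCoeff (MvPolynomial.X 0 : P) (MvPolynomial.X 1) i j).det := by
    have hf := IsFractionRing.injective P (FractionRing P)
    have : CharZero (FractionRing P) := charZero_of_injective_algebraMap hf
    refine hf ?_
    have hy : algebraMap P (FractionRing P) (MvPolynomial.X 1) ≠ 0 := fun h =>
      MvPolynomial.X_ne_zero (R := ℤ) (1 : Fin 2) (hf (h.trans (map_zero _).symm))
    rw [map_partitionFn_zero, map_det_cauchyCoeff]
    exact partitionFn_zero_eq_det (algebraMap P (FractionRing P) (MvPolynomial.X 0)) _ hy n
  have h := congrArg (MvPolynomial.eval₂Hom (Int.castRingHom R) ![x, y]) huniv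
  rw [map_partitionFn_zero, map_det_cauchyCoeff] at h
  simpa using h

@[simp] theorem cauchyCoeff_zero_right (x y : R) (i : ℕ) : cauchyCoeff x y i 0 = y ^ i := by
  cases i <;> simp [cauchyCoeff]

theorem cauchyCoeff_succ_right (x y : R) (i j : ℕ) :
    cauchyCoeff x y i (j + 1) = shiftRow (cauchyCoeff x y) i j + binomCoeff x y i (j + 1) := by
  cases i <;> simp [cauchyCoeff]

theorem cauchyCoeff_succ_left (x y : R) (i j : ℕ) :
    cauchyCoeff x y (i + 1) j = shiftCol (cauchyCoeff x y) i j + binomCoeff x y (i + 1) j := by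
  cases j <;> simp [cauchyCoeff]

theorem cauchyCoeff_eq_shift (x y : R) (i j : ℕ) :
    cauchyCoeff x y i j = shiftRow (shiftCol (cauchyCoeff x y)) i j + binomCoeff x y i j := by
  cases i <;> cases j <;> simp [cauchyCoeff]

/-- In generating functions: `(1 - ω) * wtB + ω * wtA = (1 - (1 - ω) * y * u) * (1 - (1 - ω) * v)`,
divided by `wtA * wtB`. Only the `u * v` coefficients need an argument, and they agree by `hω`. -/
theorem masm_coeff_eq {x y ω : R} (hω : y * ω ^ 2 + (1 - x - y) * ω + x = 0) (i j : ℕ) :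
    (1 - ω) * (if i = j then 1 else 0) + ω * binomCoeff x y i j =
      cauchyCoeff x y i j - (1 - ω) * shiftCol (cauchyCoeff x y) i j -
        (1 - ω) * y * (shiftRow (cauchyCoeff x y) i j -
          (1 - ω) * shiftRow (shiftCol (cauchyCoeff x y)) i j) := by
  induction i generalizing j with
  | zero => cases j <;> simp [cauchyCoeff]
  | succ i ih =>
    cases j with
    | zero => simp; ring
    | succ j =>
      have h1 := cauchyCoeff_succ_right x y i j
      have h2 := cauchyCoeff_succ_left x y i j
      have h3 := cauchyCoeff_eq_shift x y i j
      simp only [cauchyCoeff, shiftRow_succ, shiftCol_succ, Nat.succ_inj, h1, h2,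
        binomCoeff_succ_succ x y i j]
      linear_combination ih j + (1 - ω) ^ 2 * y * (-1) * h3 - binomCoeff x y i j * hω

theorem MASM_apply (n : ℕ) (x y ω : R) (i j : Fin n) :
    MASM n x y ω i j =
      (1 - ω) * (if (i : ℕ) = j then 1 else 0) + ω * binomCoeff x y i j := by
  simp only [MASM, binomCoeff, of_apply, Fin.ext_iff]

theorem det_cauchyCoeff_eq_det_MASM (n : ℕ) {x y ω : R}
    (hω : y * ω ^ 2 + (1 - x - y) * ω + x = 0) :
    (of fun i j : Fin n => cauchyCoeff x y i j).det = (MASM n x y ω).det := by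
  cases n with
  | zero => simp
  | succ n =>
    set K := cauchyCoeff x y with hK
    -- The factor in `v` is a column operation, the factor in `u` a row operation, both of
    -- determinant `1`.
    calc _ = (of fun i j : Fin (n + 1) => K i j - (1 - ω) * shiftCol K i j).det := by
          refine det_eq_of_forall_col_eq_smul_add_pred (fun _ => 1 - ω) (fun i => ?_) fun i j => ?_
          · simp
          · simp
      _ = _ := by
          refine det_eq_of_forall_row_eq_smul_add_pred (fun _ => (1 - ω) * y) (fun j => ?_)
            fun i j => ?_
          · rw [MASM_apply, masm_coeff_eq hω]
            simp [← hK]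
          · rw [MASM_apply, masm_coeff_eq hω]
            simp only [← hK, of_apply, Fin.val_succ, Fin.val_castSucc, shiftRow_succ]
            ring

end Determinant

end AlternatingSign

theorem mainTheorem5 {R : Type*} [CommRing R] (n : ℕ) (x y ω : R)
    (hω : y * ω ^ 2 + (1 - x - y) * ω + x = 0) :
    AlternatingSign.ZASM n x y 1 = (AlternatingSign.MASM n x y ω).det := by
  rw [AlternatingSign.ZASM_one_eq_det_cauchyCoeff, AlternatingSign.det_cauchyCoeff_eq_det_MASM n hω]
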